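/- Let $n\ge 2$, $q\in(1,\infty)$, and let $U\subset\mathbb R^n$ be a Lipschitz domain or a John domain (both defined below; in particular $U$ is nonempty, open, connected and bounded). For $\psi\in L^1(U)$ (real-valued) let $$\psi_U^{\#}(x):=\sup_{Q\ni x,\ Q\subset U}\ \frac1{|Q|}\int_Q\big|\psi(y)-\langle\psi\rangle_Q\big|\,dy\in[0,\infty],\qquad \langle\psi\rangle_Q:=\frac1{|Q|}\int_Q\psi(y)\,dy,\qquad x\in U,$$ where the supremum is over all nonempty bounded open cubes $Q$ with faces parallel to the coordinate hyperplanes, and $|V|$ is the Lebesgue measure of $V$. Then there is a constant $F=F(q,U)>0$ such that every $\psi\in L^1(U)$ with $\psi_U^{\#}\in L^q(U)$ satisfies $\psi\in L^q(U)$ and $$\frac1{|U|}\int_U|\psi|^q\,dx\ \le\ F\left(\frac1{|U|}\int_U\big|\psi_U^{\#}\big|^q\,dx+\Big|\frac1{|U|}\int_U\psi\,dx\Big|^q\right).$$ Definitions. A bounded domain $U$ (nonempty, open, connected, bounded) is a *Lipschitz domain* if for every $x\in\partial U$ there are a unit vector $\nu$, a Lipschitz function $g:\nu^\perp\to\mathbb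 R$ and $r>0$ such that, for all $y$ with $|y-x|<r$, $y\in U$ if and only if $g(P y)<\nu\cdot y$, where $P$ is the orthogonal projection onto $\nu^\perp$. It is a *John domain* if there are $x_0\in U$ and $\alpha>0$ such that every $x\in U$ can be joined to $x_0$ by a rectifiable path $\gamma:[0,\ell]\to U$ parametrized by arc length, with $\gamma(0)=x$, $\gamma(\ell)=x_0$ and $\operatorname{dist}(\gamma(t),\partial U)\ge t/\alpha$ for all $t\in[0,\ell]$. -/

import Mathlib

open MeasureTheory
open scoped ENNReal NNReal

/-- Euclidean space `ℝⁿ`. -/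
abbrev Rn (n : ℕ) : Type := EuclideanSpace ℝ (Fin n)

/-- The open cube with faces parallel to the coordinate hyperplanes, lower corner `a` and
side length `l`. -/
def openCube {n : ℕ} (a : Rn n) (l : ℝ) : Set (Rn n) :=
  {y | ∀ i, a i < y i ∧ y i < a i + l}

/-- The mean oscillation of `ψ` on `Q`: the average over `Q` of `|ψ - ⟨ψ⟩_Q|`. -/
noncomputable def meanOsc {n : ℕ} (ψ : Rn n → ℝ) (Q : Set (Rn n)) : ℝ≥0∞ :=
  ⨍⁻ y in Q, ‖ψ y - ⨍ z in Q, ψ z‖ₑ ∂volume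

/-- The Fefferman-Stein (sharp) maximal function of `ψ` relative to `V`: the supremum of the
mean oscillations of `ψ` on the nonempty open cubes `Q` with `x ∈ Q` and `Q ⊆ V`. -/
noncomputable def sharpMaximal {n : ℕ} (V : Set (Rn n)) (ψ : Rn n → ℝ) (x : Rn n) : ℝ≥0∞ :=
  ⨆ (a : Rn n) (l : ℝ) (_ : 0 < l) (_ : x ∈ openCube a l) (_ : openCube a l ⊆ V),
    meanOsc ψ (openCube a l)

/-- A bounded domain: a nonempty, connected, open, bounded set. -/
structure IsBoundedDomain {n : ℕ} (U : Set (Rn n)) : Prop where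
  isOpen : IsOpen U
  isConnected : IsConnected U
  isBounded : Bornology.IsBounded U

/-- A Lipschitz domain: a bounded domain which, near each of its boundary points, coincides with
the region strictly above the graph of a Lipschitz function, where the graph is taken over the
hyperplane orthogonal to some unit vector `ν` (the local "upward" direction). -/
structure IsLipschitzDomain {n : ℕ} (U : Set (Rn n)) : Prop extends IsBoundedDomain U where
  exists_graph : ∀ x ∈ frontier U, ∃ ν : Rn n, ‖ν‖ = 1 ∧
    ∃ (L : ℝ≥0) (g : (ℝ ∙ ν)ᗮ → ℝ), LipschitzWith L g ∧ ∃ r : ℝ, 0 < r ∧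
      ∀ y ∈ Metric.ball x r, y ∈ U ↔ g ((ℝ ∙ ν)ᗮ.orthogonalProjectionOnto y) < inner ℝ ν y

/-- A John domain: a bounded domain with a centre `x₀` and a constant `α > 0` such that each
`x ∈ U` is joined to `x₀` by a rectifiable path `γ : [0, l] → U`, parametrized by arc length,
whose distance from the boundary at the parameter `t` is at least `t / α`. -/
structure IsJohnDomain {n : ℕ} (U : Set (Rn n)) : Prop extends IsBoundedDomain U where
  exists_center : ∃ x₀ ∈ U, ∃ α : ℝ, 0 < α ∧ ∀ x ∈ U,
    ∃ (l : ℝ) (γ : ℝ → Rn n), 0 ≤ l ∧ HasUnitSpeedOn γ (Set.Icc 0 l) ∧ γ 0 = x ∧ γ l = x₀ ∧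
      ∀ t ∈ Set.Icc 0 l, γ t ∈ U ∧ t / α ≤ Metric.infDist (γ t) (frontier U)

/-! The proof is by duality. Axis-parallel open cubes are sup-norm balls, so the analysis takes
place on `Fin n → ℝ`. Let `M` be the uncentred maximal function over such balls (`ballMaximal`) and
let `s` dominate the oscillation of `φ` on every ball inside `V`. The core is a bilinear estimate,
`exists_lintegral_enorm_sub_mul_le`: for bounded measurable `g ≥ 0`, the integral of `|φ - c| g`
over `V` is at most a constant times that of `s · M g`, with `c` the mean of `φ` on one fixed
Whitney cube. Testing it with `g = min(|φ - c|, N) ^ (q - 1)`, then using Hölder and the boundedness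
of `M` on the conjugate Lebesgue space, gives the `L^q` bound after absorbing the left side and
letting `N → ∞`. Finally `c` is exchanged for the mean over `V`.

The bilinear estimate has a local and a global half. On a single dyadic cube `J`
(`lintegral_osc_mul_le`), a Calderón-Zygmund stopping at twice the mean oscillation leaves at least
half of `J` unselected. The oscillation times the integral of `g` is then charged to `s · M g` on
that unselected part, and the selected subcubes are treated recursively. The unselected parts of all
generations are disjoint, so the charges add up to a single integral over `J`.

Globally, `V` is cut into Whitney cubes. The means on `J` and on the central cube differ by at most
a constant times the sum of `inf_L s` over the Whitney cubes `L` met by a connected set joining `J`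
to the centre. The carrot condition `HasCarrots` places `J` inside a fixed dilate of each such `L`.
Interchanging the sums therefore leaves, for each `L`, `inf_L s` times the integral of `g` over a
dilate of `L`, and this is again controlled by the integral of `s · M g` over `L`.

The geometry of the domain enters only through `HasCarrots`. It is immediate for John domains,
follows from vertical segments and compactness for Lipschitz domains, and survives the bi-Lipschitz
passage from the Euclidean to the sup norm. -/

/-! ### The Hardy-Littlewood maximal function for the sup norm -/

/-- The uncentred maximal function over sup-norm balls. -/
noncomputable def ballMaximal {n : ℕ} (g : (Fin n → ℝ) → ℝ≥0∞) (x : Fin n → ℝ) : ℝ≥0∞ :=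
  ⨆ (z : Fin n → ℝ) (r : ℝ) (_ : 0 < r) (_ : x ∈ Metric.ball z r), ⨍⁻ y in Metric.ball z r, g y ∂volume

theorem laverage_le_ballMaximal {n : ℕ} (g : (Fin n → ℝ) → ℝ≥0∞) {x z : Fin n → ℝ} {r : ℝ}
    (hr : 0 < r) (hx : x ∈ Metric.ball z r) :
    (⨍⁻ y in Metric.ball z r, g y ∂volume) ≤ ballMaximal g x :=
  le_iSup_of_le z <| le_iSup_of_le r <| le_iSup_of_le hr <| le_iSup_of_le hx le_rfl

theorem setOf_lt_ballMaximal {n : ℕ} (g : (Fin n → ℝ) → ℝ≥0∞) (t : ℝ≥0∞) :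
    {x | t < ballMaximal g x} =
      ⋃ b ∈ {b : (Fin n → ℝ) × ℝ | 0 < b.2 ∧ t < ⨍⁻ y in Metric.ball b.1 b.2, g y ∂volume},
        Metric.ball b.1 b.2 := by
  ext x
  simp only [ballMaximal, Set.mem_ofPred_eq, lt_iSup_iff, Set.mem_iUnion, Prod.exists]
  constructor
  · rintro ⟨z, r, hr, hx, h⟩
    exact ⟨z, r, ⟨hr, h⟩, hx⟩
  · rintro ⟨z, r, ⟨hr, h⟩, hx⟩
    exact ⟨z, r, hr, hx, h⟩

theorem isOpen_lt_ballMaximal {n : ℕ} (g : (Fin n → ℝ) → ℝ≥0∞) (t : ℝ≥0∞) :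
    IsOpen {x | t < ballMaximal g x} := by
  rw [setOf_lt_ballMaximal]
  exact isOpen_biUnion fun _ _ => Metric.isOpen_ball

theorem measurable_ballMaximal {n : ℕ} (g : (Fin n → ℝ) → ℝ≥0∞) : Measurable (ballMaximal g) :=
  measurable_of_Ioi fun t => (isOpen_lt_ballMaximal g t).measurableSet

theorem volume_ball_ne_zero {n : ℕ} (z : Fin n → ℝ) {r : ℝ} (hr : 0 < r) :
    volume (Metric.ball z r) ≠ 0 := (Metric.measure_ball_pos volume z hr).ne'

theorem volume_ball_ne_top {n : ℕ} (z : Fin n → ℝ) (r : ℝ) :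
    volume (Metric.ball z r) ≠ ⊤ := measure_ball_lt_top.ne

theorem ballMaximal_le_add {n : ℕ} (g : (Fin n → ℝ) → ℝ≥0∞) (t : ℝ≥0∞)
    (x : Fin n → ℝ) : ballMaximal g x ≤ t + ballMaximal ({y | t < g y}.indicator g) x := by
  refine iSup_le fun z => iSup_le fun r => iSup_le fun hr => iSup_le fun hx => ?_
  have h1 : ∀ y, g y ≤ t + ({y | t < g y}.indicator g) y := fun y => by
    by_cases h : t < g y
    · simp [Set.indicator, h]
    · exact (not_lt.1 h).trans le_self_add
  calc (⨍⁻ y in Metric.ball z r, g y ∂volume)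
      ≤ ⨍⁻ y in Metric.ball z r, (t + ({y | t < g y}.indicator g) y) ∂volume := by
        simp only [setLAverage_eq]; gcongr with y; exact h1 y
    _ = t + ⨍⁻ y in Metric.ball z r, ({y | t < g y}.indicator g) y ∂volume := by
        simp only [setLAverage_eq]
        rw [lintegral_add_left measurable_const, ENNReal.add_div, setLIntegral_const,
          ENNReal.mul_div_cancel_right (volume_ball_ne_zero z hr) (volume_ball_ne_top z r)]
    _ ≤ _ := by gcongr; exact laverage_le_ballMaximal _ hr hx

theorem ballMaximal_le_of_le {n : ℕ} {g : (Fin n → ℝ) → ℝ≥0∞} {G : ℝ≥0∞} (hG : ∀ x, g x ≤ G)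
    (x : Fin n → ℝ) : ballMaximal g x ≤ G := by
  refine iSup_le fun z => iSup_le fun r => iSup_le fun hr => iSup_le fun hx => ?_
  rw [setLAverage_eq]
  refine ENNReal.div_le_of_le_mul ?_
  calc _ ≤ ∫⁻ y in Metric.ball z r, G := lintegral_mono fun y => hG y
    _ = _ := by simp

theorem volume_closedBall_five_mul {n : ℕ} (z : Fin n → ℝ) {r : ℝ} (hr : 0 < r) :
    volume (Metric.closedBall z (5 * r)) = 5 ^ n * volume (Metric.ball z r) := by
  rw [Real.volume_pi_closedBall _ (by positivity), Real.volume_pi_ball _ hr, ← mul_assoc,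
    mul_comm 2 (5 : ℝ), mul_assoc, mul_pow, ENNReal.ofReal_mul (by positivity)]
  simp [ENNReal.ofReal_pow]

/-- Weak type (1,1) by the Vitali covering lemma: a disjoint subfamily of the balls with average
above `t` covers the level set after enlargement by the factor 5. -/
theorem mul_volume_lt_ballMaximal_le {n : ℕ} (hn : 0 < n) (g : (Fin n → ℝ) → ℝ≥0∞)
    {t : ℝ≥0∞} (ht : t ≠ 0) (ht' : t ≠ ⊤) :
    t * volume {x | t < ballMaximal g x} ≤ 5 ^ n * ∫⁻ x, g x := by
  by_cases hfin : ∫⁻ x, g x = ⊤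
  · rw [hfin, ENNReal.mul_top (by positivity)]; exact le_top
  set T : Set ((Fin n → ℝ) × ℝ) :=
    {b | 0 < b.2 ∧ t < ⨍⁻ y in Metric.ball b.1 b.2, g y ∂volume} with hT
  have key : ∀ b ∈ T, t * volume (Metric.ball b.1 b.2) ≤ ∫⁻ y in Metric.ball b.1 b.2, g y := by
    rintro b ⟨hb, hb'⟩
    rw [setLAverage_eq] at hb'
    exact ((ENNReal.lt_div_iff_mul_lt (Or.inl (volume_ball_ne_zero _ hb))
      (Or.inl (volume_ball_ne_top _ _))).1 hb').le
  -- Vitali needs bounded radii: the volume `(2r)^n` of an admissible ball is at most `(∫ g) / t`,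
  -- and either `2r ≤ 1` or `2r ≤ (2r)^n`.
  have hR : ∀ b ∈ T, b.2 ≤ 1 + ((∫⁻ x, g x) / t).toReal := by
    intro b hb
    have h1 : volume (Metric.ball b.1 b.2) ≤ (∫⁻ x, g x) / t := by
      rw [ENNReal.le_div_iff_mul_le (Or.inl ht) (Or.inl ht'), mul_comm]
      exact (key b hb).trans (setLIntegral_le_lintegral _ _)
    have h2 : (∫⁻ x, g x) / t ≠ ⊤ := ENNReal.div_ne_top hfin ht
    rw [Real.volume_pi_ball _ hb.1, ← ENNReal.ofReal_toReal h2,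
      ENNReal.ofReal_le_ofReal_iff ENNReal.toReal_nonneg, Fintype.card_fin] at h1
    have hb0 := hb.1
    by_cases h : 2 * b.2 ≤ 1
    · have := @ENNReal.toReal_nonneg ((∫⁻ x, g x) / t); linarith
    · have := le_self_pow₀ (not_le.1 h).le hn.ne'
      linarith
  obtain ⟨u, huT, hdisj, hcov⟩ := Vitali.exists_disjoint_subfamily_covering_enlargement_closedBall
    T (fun b => b.1) (fun b => b.2) _ hR 5 (by norm_num)
  have hu : u.Countable := hdisj.countable_of_nonempty_interior fun b hb => by
    refine ⟨b.1, ?_⟩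
    exact mem_interior.2 ⟨_, Metric.ball_subset_closedBall, Metric.isOpen_ball,
      Metric.mem_ball_self (huT hb).1⟩
  have hsub : {x | t < ballMaximal g x} ⊆ ⋃ b ∈ u, Metric.closedBall b.1 (5 * b.2) := by
    rw [setOf_lt_ballMaximal]
    refine Set.iUnion₂_subset fun b hb => ?_
    obtain ⟨c, hc, hbc⟩ := hcov b hb
    exact (Metric.ball_subset_closedBall.trans hbc).trans
      (Set.subset_biUnion_of_mem (u := fun b : (Fin n → ℝ) × ℝ =>
        Metric.closedBall b.1 (5 * b.2)) hc)
  calc t * volume {x | t < ballMaximal g x}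
      ≤ t * ∑' b : u, volume (Metric.closedBall b.1.1 (5 * b.1.2)) := by
        gcongr
        exact (measure_mono hsub).trans (measure_biUnion_le _ hu _)
    _ = 5 ^ n * ∑' b : u, t * volume (Metric.ball b.1.1 b.1.2) := by
        rw [← ENNReal.tsum_mul_left, ← ENNReal.tsum_mul_left]
        refine tsum_congr fun b => ?_
        rw [volume_closedBall_five_mul _ (huT b.2).1]; ring
    _ ≤ 5 ^ n * ∑' b : u, ∫⁻ y in Metric.ball b.1.1 b.1.2, g y := by
        gcongr with b; exact key b.1 (huT b.2)
    _ = 5 ^ n * ∫⁻ y in ⋃ b ∈ u, Metric.ball b.1 b.2, g y := by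
        rw [lintegral_biUnion hu (fun _ _ => Metric.isOpen_ball.measurableSet)]
        exact hdisj.mono fun b => Metric.ball_subset_closedBall
    _ ≤ _ := mul_le_mul_right (setLIntegral_le_lintegral _ _) _

/-- The part of `g` below `t / 2` contributes at most `t / 2` to the maximal function, so the weak
type bound is needed only for the part above. This is the input for interpolation with the trivial
sup bound. -/
theorem volume_lt_ballMaximal_le {n : ℕ} (hn : 0 < n) {g : (Fin n → ℝ) → ℝ≥0∞}
    (hg : Measurable g) {t : ℝ} (ht : 0 < t) :
    volume {x | ENNReal.ofReal t < ballMaximal g x} ≤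
      2 * 5 ^ n * (ENNReal.ofReal t⁻¹ * ∫⁻ x in {y | ENNReal.ofReal (t / 2) < g y}, g x) := by
  have ht2 : ENNReal.ofReal (t / 2) ≠ 0 := by simp [ht]
  set h := {y | ENNReal.ofReal (t / 2) < g y}.indicator g
  have hsub : {x | ENNReal.ofReal t < ballMaximal g x} ⊆
      {x | ENNReal.ofReal (t / 2) < ballMaximal h x} := by
    intro x hx
    by_contra hc
    have h1 := ballMaximal_le_add g (ENNReal.ofReal (t / 2)) x
    have h2 : ENNReal.ofReal (t / 2) + ballMaximal h x ≤ ENNReal.ofReal t := by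
      calc _ ≤ ENNReal.ofReal (t / 2) + ENNReal.ofReal (t / 2) := by gcongr; exact not_lt.1 hc
        _ = _ := by rw [← ENNReal.ofReal_add (by positivity) (by positivity), add_halves]
    exact absurd (lt_of_lt_of_le hx (h1.trans h2)) (lt_irrefl _)
  have hw := mul_volume_lt_ballMaximal_le hn h ht2 ENNReal.ofReal_ne_top
  have hint : ∫⁻ x, h x = ∫⁻ x in {y | ENNReal.ofReal (t / 2) < g y}, g x :=
    lintegral_indicator (measurableSet_lt measurable_const hg) _
  rw [hint] at hw
  calc volume {x | ENNReal.ofReal t < ballMaximal g x}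
      ≤ volume {x | ENNReal.ofReal (t / 2) < ballMaximal h x} := measure_mono hsub
    _ = ENNReal.ofReal (2 * t⁻¹) * (ENNReal.ofReal (t / 2) *
          volume {x | ENNReal.ofReal (t / 2) < ballMaximal h x}) := by
        rw [← mul_assoc, ← ENNReal.ofReal_mul (by positivity)]
        have : 2 * t⁻¹ * (t / 2) = 1 := by field_simp
        rw [this]; simp
    _ ≤ ENNReal.ofReal (2 * t⁻¹) *
          (5 ^ n * ∫⁻ x in {y | ENNReal.ofReal (t / 2) < g y}, g x) := by gcongr
    _ = _ := by
        rw [ENNReal.ofReal_mul (by norm_num)]; simp only [ENNReal.ofReal_ofNat]; ring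

theorem lintegral_Ioo_rpow {p : ℝ} (hp : 1 < p) {b : ℝ} (hb : 0 ≤ b) :
    ∫⁻ t in Set.Ioo 0 b, ENNReal.ofReal (t ^ (p - 2)) = ENNReal.ofReal (b ^ (p - 1) / (p - 1)) := by
  rw [restrict_Ioo_eq_restrict_Ioc, ← ofReal_integral_eq_lintegral_ofReal,
    ← intervalIntegral.integral_of_le hb, integral_rpow (Or.inl (by linarith))]
  · rw [Real.zero_rpow (by linarith)]
    ring_nf
  · exact (intervalIntegral.intervalIntegrable_rpow' (by linarith)).1
  · refine (ae_restrict_iff' measurableSet_Ioc).2 (.of_forall fun t ht => ?_)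
    exact Real.rpow_nonneg ht.1.le _

/-- Marcinkiewicz interpolation: the layer-cake formula, the truncated weak type bound, and Tonelli.
Boundedness of `g` makes its maximal function finite, so that the real-valued layer-cake formula
applies; the constant does not depend on the bound. -/
theorem lintegral_ballMaximal_rpow_le {n : ℕ} (hn : 0 < n) {p : ℝ} (hp : 1 < p)
    {g : (Fin n → ℝ) → ℝ≥0∞} (hg : Measurable g) {G : ℝ≥0} (hG : ∀ x, g x ≤ G) :
    ∫⁻ x, ballMaximal g x ^ p ≤
      ENNReal.ofReal (p * (2 * 5 ^ n) * (2 ^ (p - 1) / (p - 1))) * ∫⁻ x, g x ^ p := by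
  have hMfin : ∀ x, ballMaximal g x ≠ ⊤ := fun x =>
    ((ballMaximal_le_of_le hG x).trans_lt ENNReal.coe_lt_top).ne
  have hgfin : ∀ x, g x ≠ ⊤ := fun x => ((hG x).trans_lt ENNReal.coe_lt_top).ne
  have hp0 : 0 < p := by linarith
  have hset : ∀ t : ℝ, 0 < t → {x | t < (ballMaximal g x).toReal} =
      {x | ENNReal.ofReal t < ballMaximal g x} := fun t ht => by
    ext x
    simp only [Set.mem_ofPred_eq]
    rw [ENNReal.ofReal_lt_iff_lt_toReal ht.le (hMfin x)]
  have hm1 : Measurable fun a : (Fin n → ℝ) × ℝ =>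
      ({y : (Fin n → ℝ) × ℝ | ENNReal.ofReal (y.2 / 2) < g y.1}.indicator (fun a => g a.1) a) :=
    (hg.comp measurable_fst).indicator
      (measurableSet_lt (measurable_snd.div_const 2).ennreal_ofReal (hg.comp measurable_fst))
  have hsplit : ∀ t x, ({y | ENNReal.ofReal (t / 2) < g y}.indicator g) x =
      ({y : (Fin n → ℝ) × ℝ | ENNReal.ofReal (y.2 / 2) < g y.1}.indicator
        (fun a => g a.1) (x, t)) := fun t x => by simp [Set.indicator]
  calc ∫⁻ x, ballMaximal g x ^ p
      = ∫⁻ x, ENNReal.ofReal ((ballMaximal g x).toReal ^ p) := by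
        refine lintegral_congr fun x => ?_
        rw [← ENNReal.ofReal_rpow_of_nonneg ENNReal.toReal_nonneg hp0.le,
          ENNReal.ofReal_toReal (hMfin x)]
    _ = ENNReal.ofReal p * ∫⁻ t in Set.Ioi 0, volume {x | t < (ballMaximal g x).toReal} *
          ENNReal.ofReal (t ^ (p - 1)) :=
        lintegral_rpow_eq_lintegral_meas_lt_mul _ (.of_forall fun _ => ENNReal.toReal_nonneg)
          (measurable_ballMaximal g).ennreal_toReal.aemeasurable hp0
    _ ≤ ENNReal.ofReal p * ∫⁻ t in Set.Ioi 0, 2 * 5 ^ n * (ENNReal.ofReal (t ^ (p - 2)) *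
          ∫⁻ x, ({y | ENNReal.ofReal (t / 2) < g y}.indicator g) x) := by
        gcongr 1
        refine setLIntegral_mono' measurableSet_Ioi fun t ht => ?_
        have ht : 0 < t := ht
        rw [hset t ht]
        refine (mul_le_mul_left (volume_lt_ballMaximal_le hn hg ht) _).trans (le_of_eq ?_)
        rw [lintegral_indicator (measurableSet_lt measurable_const hg)]
        have : ENNReal.ofReal (t ^ (p - 2)) = ENNReal.ofReal t⁻¹ * ENNReal.ofReal (t ^ (p - 1)) := by
          rw [← ENNReal.ofReal_mul (by positivity), ← Real.rpow_neg_one, ← Real.rpow_add ht]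
          ring_nf
        rw [this]; ring
    _ = ENNReal.ofReal p * (2 * 5 ^ n) * ∫⁻ t in Set.Ioi 0, ∫⁻ x, ENNReal.ofReal (t ^ (p - 2)) *
          ({y | ENNReal.ofReal (t / 2) < g y}.indicator g) x := by
        rw [lintegral_const_mul' _ _ (by finiteness), ← mul_assoc]
        refine congrArg _ (lintegral_congr fun t => ?_)
        rw [lintegral_const_mul' _ _ ENNReal.ofReal_ne_top]
    _ = ENNReal.ofReal p * (2 * 5 ^ n) * ∫⁻ x, ∫⁻ t in Set.Ioi 0, ENNReal.ofReal (t ^ (p - 2)) *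
          ({y | ENNReal.ofReal (t / 2) < g y}.indicator g) x := by
        congr 1
        refine lintegral_lintegral_swap (Measurable.aemeasurable ?_)
        simp only [Function.uncurry_def, hsplit]
        refine Measurable.mul (by fun_prop) ?_
        exact hm1.comp measurable_swap
    _ = ENNReal.ofReal p * (2 * 5 ^ n) *
          ∫⁻ x, ENNReal.ofReal (2 ^ (p - 1) / (p - 1)) * g x ^ p := by
        congr 1
        refine lintegral_congr fun x => ?_
        set b := (g x).toReal
        have hb : 0 ≤ b := ENNReal.toReal_nonneg
        have hgx : g x = ENNReal.ofReal b := (ENNReal.ofReal_toReal (hgfin x)).symm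
        have : ∀ t ∈ Set.Ioi (0:ℝ), ENNReal.ofReal (t ^ (p - 2)) *
            ({y | ENNReal.ofReal (t / 2) < g y}.indicator g) x =
            (Set.Ioo 0 (2 * b)).indicator (fun t => ENNReal.ofReal (t ^ (p - 2)) * g x) t := by
          intro t ht
          have ht : 0 < t := ht
          have hiff : ENNReal.ofReal (t / 2) < g x ↔ t < 2 * b := by
            rw [ENNReal.ofReal_lt_iff_lt_toReal (by positivity) (hgfin x), div_lt_iff₀' two_pos]
          by_cases h : t < 2 * b
          · simp [Set.indicator, hiff, h, ht]
          · simp [Set.indicator, hiff, h]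
        rw [setLIntegral_congr_fun measurableSet_Ioi this, lintegral_indicator measurableSet_Ioo,
          Measure.restrict_restrict measurableSet_Ioo,
          Set.inter_eq_self_of_subset_left Set.Ioo_subset_Ioi_self,
          lintegral_mul_const' _ _ (hgfin x), lintegral_Ioo_rpow hp (by positivity), hgx,
          ENNReal.ofReal_rpow_of_nonneg hb hp0.le,
          ← ENNReal.ofReal_mul (by have : 0 < p - 1 := by linarith
                                   positivity),
          ← ENNReal.ofReal_mul (by have : 0 < p - 1 := by linarith
                                   positivity)]
        congr 1
        rcases hb.eq_or_lt with hb0 | hb0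
        · rw [← hb0, Real.zero_rpow hp0.ne']; simp
        · rw [Real.mul_rpow (by norm_num) hb, Real.rpow_sub_one hb0.ne' p]
          field_simp
    _ = _ := by
        rw [lintegral_const_mul' _ _ ENNReal.ofReal_ne_top, ← mul_assoc]
        congr 1
        have : 0 < p - 1 := by linarith
        rw [ENNReal.ofReal_mul (by positivity), ENNReal.ofReal_mul (by positivity)]
        congr 2
        rw [ENNReal.ofReal_mul (by norm_num), ENNReal.ofReal_pow (by norm_num)]
        simp

/-! ### Dyadic cubes -/

/-- The dyadic cube with side `2 ^ (-J.1)` and lower corner `2 ^ (-J.1) * J.2`. -/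
def dyad {n : ℕ} (J : ℤ × (Fin n → ℤ)) : Set (Fin n → ℝ) :=
  {y | ∀ i, ⌊y i * 2 ^ J.1⌋ = J.2 i}

/-- The side length of a dyadic cube. -/
noncomputable def dyadSide {n : ℕ} (J : ℤ × (Fin n → ℤ)) : ℝ := 2 ^ (-J.1)

/-- The centre of a dyadic cube. -/
noncomputable def dyadCenter {n : ℕ} (J : ℤ × (Fin n → ℤ)) : Fin n → ℝ :=
  fun i => (J.2 i + 1 / 2) * dyadSide J

/-- The open sup-norm ball which is the interior of a dyadic cube. -/
noncomputable def dyadBall {n : ℕ} (J : ℤ × (Fin n → ℤ)) : Set (Fin n → ℝ) :=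
  Metric.ball (dyadCenter J) (dyadSide J / 2)

/-- The dyadic cube of side `2 ^ (-k)` containing `x`. -/
noncomputable def dyadAt {n : ℕ} (k : ℤ) (x : Fin n → ℝ) : ℤ × (Fin n → ℤ) :=
  (k, fun i => ⌊x i * 2 ^ k⌋)

section dyad

variable {n : ℕ} {J J' : ℤ × (Fin n → ℤ)} {x y : Fin n → ℝ} {k : ℤ}

theorem dyadSide_pos (J : ℤ × (Fin n → ℤ)) : 0 < dyadSide J := by
  unfold dyadSide; positivity

theorem mem_dyadAt (k : ℤ) (x : Fin n → ℝ) : x ∈ dyad (dyadAt k x) := fun _ => rfl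

theorem dyadAt_eq (h : x ∈ dyad J) : dyadAt J.1 x = J := Prod.ext rfl (funext h)

theorem mem_dyad_iff : x ∈ dyad J ↔
    ∀ i, J.2 i * dyadSide J ≤ x i ∧ x i < (J.2 i + 1) * dyadSide J := by
  refine forall_congr' fun i => ?_
  have h : (0 : ℝ) < 2 ^ J.1 := by positivity
  rw [Int.floor_eq_iff, dyadSide, zpow_neg, ← div_eq_mul_inv, ← div_eq_mul_inv, div_le_iff₀ h,
    lt_div_iff₀ h]

theorem dyadBall_subset (J : ℤ × (Fin n → ℤ)) : dyadBall J ⊆ dyad J := by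
  intro x hx
  rw [mem_dyad_iff]
  intro i
  have := (dist_le_pi_dist x (dyadCenter J) i).trans_lt hx
  rw [Real.dist_eq, abs_lt, dyadCenter] at this
  constructor <;> nlinarith

theorem dyad_subset_closedBall (J : ℤ × (Fin n → ℤ)) :
    dyad J ⊆ Metric.closedBall (dyadCenter J) (dyadSide J / 2) := by
  intro x hx
  rw [mem_dyad_iff] at hx
  have := dyadSide_pos J
  rw [Metric.mem_closedBall, dist_pi_le_iff (by positivity)]
  intro i
  have := hx i
  rw [Real.dist_eq, abs_le, dyadCenter]
  constructor <;> nlinarith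

theorem dist_le_dyadSide (hx : x ∈ dyad J) (hy : y ∈ dyad J) : dist x y ≤ dyadSide J := by
  have h1 := dyad_subset_closedBall J hx
  have h2 := dyad_subset_closedBall J hy
  have := dist_triangle_right x y (dyadCenter J)
  rw [Metric.mem_closedBall] at h1 h2
  linarith

theorem measurableSet_dyad (J : ℤ × (Fin n → ℤ)) : MeasurableSet (dyad J) := by
  have : dyad J = ⋂ i, {y | ⌊y i * 2 ^ J.1⌋ = J.2 i} := by ext; simp [dyad]
  rw [this]
  refine MeasurableSet.iInter fun i => ?_
  exact (Int.measurable_floor.comp ((measurable_pi_apply i).mul_const _))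
    (measurableSet_singleton (J.2 i))

theorem volume_dyadBall (J : ℤ × (Fin n → ℤ)) :
    volume (dyadBall J) = ENNReal.ofReal (dyadSide J ^ n) := by
  have := dyadSide_pos J
  rw [dyadBall, Real.volume_pi_ball _ (by positivity), Fintype.card_fin, mul_div_cancel₀ _ two_ne_zero]

theorem dyadBall_ae_eq_closedBall (J : ℤ × (Fin n → ℤ)) :
    dyadBall J =ᵐ[volume] Metric.closedBall (dyadCenter J) (dyadSide J / 2) := by
  have := dyadSide_pos J
  refine ae_eq_of_subset_of_measure_ge Metric.ball_subset_closedBall ?_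
    Metric.isOpen_ball.measurableSet.nullMeasurableSet measure_closedBall_lt_top.ne
  rw [volume_dyadBall, Real.volume_pi_closedBall _ (by positivity), Fintype.card_fin,
    mul_div_cancel₀ _ two_ne_zero]

/-- Dyadic cubes are half-open, whereas oscillations and maximal averages are taken over open balls;
this lets one pass between them. -/
theorem dyad_ae_eq_dyadBall (J : ℤ × (Fin n → ℤ)) : dyad J =ᵐ[volume] dyadBall J :=
  ((dyad_subset_closedBall J).eventuallyLE.trans (dyadBall_ae_eq_closedBall J).symm.le).antisymm
    (dyadBall_subset J).eventuallyLE

theorem volume_dyad (J : ℤ × (Fin n → ℤ)) :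
    volume (dyad J) = ENNReal.ofReal (dyadSide J ^ n) := by
  rw [measure_congr (dyad_ae_eq_dyadBall J), volume_dyadBall]

theorem volume_dyad_ne_zero (J : ℤ × (Fin n → ℤ)) : volume (dyad J) ≠ 0 := by
  have := dyadSide_pos J
  rw [volume_dyad]; simp [this]

theorem volume_dyad_ne_top (J : ℤ × (Fin n → ℤ)) : volume (dyad J) ≠ ⊤ := by
  rw [volume_dyad]; exact ENNReal.ofReal_ne_top

theorem dyad_subset_of_le (hx : x ∈ dyad J) (hx' : x ∈ dyad J') (h : J.1 ≤ J'.1) :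
    dyad J' ⊆ dyad J := by
  obtain ⟨d, hd⟩ := Int.le.dest h
  -- The finer index determines the coarser one by integer division, hence nestedness.
  have key : ∀ t : ℝ, ⌊t * 2 ^ J.1⌋ = ⌊t * 2 ^ J'.1⌋ / (2 ^ d : ℕ) := fun t => by
    rw [← Int.floor_div_natCast, ← hd, zpow_add₀ two_ne_zero]
    congr 1
    push_cast
    rw [zpow_natCast]
    field_simp
  intro y hy i
  rw [key, hy i, ← hx' i, ← key, hx i]

theorem dyad_eq_or_disjoint_of_fst_eq (h : J.1 = J'.1) (hx : x ∈ dyad J) (hx' : x ∈ dyad J') :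
    J = J' := by
  rw [← dyadAt_eq hx, ← dyadAt_eq hx', h]

theorem dyadSide_dyadAt (k : ℤ) (x : Fin n → ℝ) : dyadSide (dyadAt k x) = 2 ^ (-k) := rfl

theorem volume_dyadAt_sub_one (k : ℤ) (x : Fin n → ℝ) :
    volume (dyad (dyadAt (k - 1) x)) = 2 ^ n * volume (dyad (dyadAt k x)) := by
  rw [volume_dyad, volume_dyad, dyadSide_dyadAt, dyadSide_dyadAt, neg_sub, sub_eq_add_neg,
    zpow_add₀ two_ne_zero, mul_pow, ENNReal.ofReal_mul (by positivity), zpow_one,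
    ENNReal.ofReal_pow (by norm_num)]
  simp

theorem tendsto_dyadSide_dyadAt (x : Fin n → ℝ) :
    Filter.Tendsto (fun k : ℕ => dyadSide (dyadAt (k : ℤ) x)) Filter.atTop (nhds 0) := by
  simp only [dyadSide_dyadAt, zpow_neg, zpow_natCast]
  exact tendsto_inv_atTop_zero.comp (tendsto_pow_atTop_atTop_of_one_lt (one_lt_two (α := ℝ)))

/-- Lebesgue differentiation along the dyadic cubes containing `x`, which agree almost everywhere
with closed balls shrinking to `x`. One null set serves all thresholds `T`. -/
theorem ae_enorm_sub_le_of_eventually_setLIntegral_dyad_le {φ : (Fin n → ℝ) → ℝ}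
    (hφ : Integrable φ) (c : ℝ) :
    ∀ᵐ x, ∀ T : ℝ≥0∞, (∀ᶠ k : ℕ in Filter.atTop,
      ∫⁻ y in dyad (dyadAt (k : ℤ) x), ‖φ y - c‖ₑ ≤ T * volume (dyad (dyadAt (k : ℤ) x))) →
      ‖φ x - c‖ₑ ≤ T := by
  have hli : LocallyIntegrable (fun y => ‖φ y - c‖) :=
    fun x => (hφ.locallyIntegrable.sub (locallyIntegrable_const c) x).norm
  filter_upwards [IsUnifLocDoublingMeasure.ae_tendsto_average volume hli 1] with x hx T hT
  have hlim := hx (l := Filter.atTop) (fun k : ℕ => dyadCenter (dyadAt (k : ℤ) x))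
    (fun k : ℕ => dyadSide (dyadAt (k : ℤ) x) / 2)
    (tendsto_nhdsWithin_iff.2 ⟨by simpa using (tendsto_dyadSide_dyadAt x).div_const 2,
      .of_forall fun k => half_pos (dyadSide_pos _)⟩)
    (.of_forall fun k => by
      rw [one_mul]; exact dyad_subset_closedBall _ (mem_dyadAt _ x))
  have hlim' := (ENNReal.continuous_ofReal.tendsto _).comp hlim
  rw [ofReal_norm] at hlim'
  refine le_of_tendsto hlim' ?_
  filter_upwards [hT] with k hk
  have hae : dyad (dyadAt (k : ℤ) x) =ᵐ[volume] _ :=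
    (dyad_ae_eq_dyadBall _).trans (dyadBall_ae_eq_closedBall _)
  simp only [Function.comp]
  rw [← setAverage_congr hae, ofReal_setAverage]
  · simp only [ofReal_norm]
    exact ENNReal.div_le_of_le_mul hk
  · refine ((hli.integrableOn_isCompact (isCompact_closedBall
      (dyadCenter (dyadAt (k : ℤ) x)) (dyadSide (dyadAt (k : ℤ) x) / 2))).mono_set
        (dyad_subset_closedBall _))
  · exact .of_forall fun _ => norm_nonneg _

end dyad

/-! ### Calderón-Zygmund decomposition and the local estimate -/

/-- The mean oscillation of `φ` on `S`, for functions on `Fin n → ℝ`. -/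
noncomputable def piOsc {n : ℕ} (φ : (Fin n → ℝ) → ℝ) (S : Set (Fin n → ℝ)) : ℝ≥0∞ :=
  ⨍⁻ y in S, ‖φ y - ⨍ z in S, φ z‖ₑ ∂volume

/-- `s` dominates the mean oscillation of `φ` on every sup-norm ball contained in `V`. -/
def OscDominated {n : ℕ} (V : Set (Fin n → ℝ)) (φ : (Fin n → ℝ) → ℝ)
    (s : (Fin n → ℝ) → ℝ≥0∞) : Prop :=
  ∀ z r, 0 < r → Metric.ball z r ⊆ V → ∀ x ∈ Metric.ball z r, piOsc φ (Metric.ball z r) ≤ s x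

section local_estimate

variable {n : ℕ} {φ : (Fin n → ℝ) → ℝ} {V : Set (Fin n → ℝ)} {s g : (Fin n → ℝ) → ℝ≥0∞}

theorem piOsc_congr {S T : Set (Fin n → ℝ)} (h : S =ᵐ[volume] T) : piOsc φ S = piOsc φ T := by
  rw [piOsc, piOsc, setLAverage_congr h, setAverage_congr h]

theorem piOsc_mul_volume {S : Set (Fin n → ℝ)} (h0 : volume S ≠ 0) (h1 : volume S ≠ ⊤) :
    piOsc φ S * volume S = ∫⁻ y in S, ‖φ y - ⨍ z in S, φ z‖ₑ := by
  rw [piOsc, setLAverage_eq, ENNReal.div_mul_cancel h0 h1]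

theorem lintegral_enorm_sub_const_lt_top (hφ : Integrable φ) {S : Set (Fin n → ℝ)}
    (h1 : volume S ≠ ⊤) (c : ℝ) : ∫⁻ y in S, ‖φ y - c‖ₑ < ⊤ :=
  ((hφ.integrableOn (s := S)).sub (integrableOn_const h1)).hasFiniteIntegral

theorem piOsc_lt_top (hφ : Integrable φ) {S : Set (Fin n → ℝ)} (h0 : volume S ≠ 0)
    (h1 : volume S ≠ ⊤) : piOsc φ S < ⊤ := by
  rw [piOsc, setLAverage_eq]
  exact ENNReal.div_lt_top (lintegral_enorm_sub_const_lt_top hφ h1 _).ne h0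

theorem enorm_setAverage_sub_mul_le (hφ : Integrable φ) {S : Set (Fin n → ℝ)}
    (h0 : volume S ≠ 0) (h1 : volume S ≠ ⊤) (c : ℝ) :
    ‖(⨍ z in S, φ z) - c‖ₑ * volume S ≤ ∫⁻ y in S, ‖φ y - c‖ₑ := by
  have h2 : (volume.real S) ≠ 0 := (ENNReal.toReal_pos h0 h1).ne'
  have h3 : ∫ y in S, (φ y - c) = volume.real S * ((⨍ z in S, φ z) - c) := by
    rw [integral_sub hφ.integrableOn (integrableOn_const h1), setAverage_eq]
    simp only [integral_const, smul_eq_mul, measureReal_restrict_apply_univ]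
    field_simp
  calc ‖(⨍ z in S, φ z) - c‖ₑ * volume S = ‖∫ y in S, (φ y - c)‖ₑ := by
        rw [h3, enorm_mul, mul_comm]
        congr 1
        rw [Real.enorm_of_nonneg measureReal_nonneg, ofReal_measureReal h1]
    _ ≤ _ := enorm_integral_le_lintegral_enorm _

theorem dyadCenter_mem (J : ℤ × (Fin n → ℤ)) : dyadCenter J ∈ dyad J :=
  dyadBall_subset J (Metric.mem_ball_self (half_pos (dyadSide_pos J)))

/-- Stopping time: `S` consists of the first proper subcubes on which the average of `|φ - c|`
exceeds `2 * o`. Chebyshev bounds their total volume by half of that of `J`, the unselected parent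
costs the factor `2 ^ n`, and differentiation handles the points never selected. -/
theorem exists_calderonZygmund (hφ : Integrable φ) (c : ℝ)
    (J : ℤ × (Fin n → ℤ)) {o : ℝ≥0∞} (ho : o ≠ ⊤)
    (hJ : ∫⁻ y in dyad J, ‖φ y - c‖ₑ ≤ o * volume (dyad J)) :
    ∃ S : Set (ℤ × (Fin n → ℤ)), S.PairwiseDisjoint dyad ∧ (∀ K ∈ S, dyad K ⊆ dyad J) ∧
      2 * ∑' K : S, volume (dyad K.1) ≤ volume (dyad J) ∧
      (∀ K ∈ S, ∫⁻ y in dyad K, ‖φ y - c‖ₑ ≤ 2 ^ n * (2 * o) * volume (dyad K)) ∧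
      ∀ᵐ x, x ∈ dyad J → x ∉ ⋃ K ∈ S, dyad K → ‖φ x - c‖ₑ ≤ 2 * o := by
  set S : Set (ℤ × (Fin n → ℤ)) := {K | J.1 < K.1 ∧ dyad K ⊆ dyad J ∧
    2 * o * volume (dyad K) < ∫⁻ y in dyad K, ‖φ y - c‖ₑ ∧
    ∀ K' : ℤ × (Fin n → ℤ), J.1 ≤ K'.1 → K'.1 < K.1 → dyad K ⊆ dyad K' →
      ∫⁻ y in dyad K', ‖φ y - c‖ₑ ≤ 2 * o * volume (dyad K')} with hS
  have hlt : ∀ K ∈ S, ∀ K' ∈ S, ∀ x, x ∈ dyad K → x ∈ dyad K' → ¬ K.1 < K'.1 := by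
    intro K hK K' hK' x hx hx' hlt
    exact absurd (hK'.2.2.2 K hK.1.le hlt (dyad_subset_of_le hx hx' hlt.le)) (not_le.2 hK.2.2.1)
  have hdisj : S.PairwiseDisjoint dyad := by
    intro K hK K' hK' hne
    refine Set.disjoint_left.2 fun x hx hx' => hne ?_
    exact dyad_eq_or_disjoint_of_fst_eq (le_antisymm (not_lt.1 (hlt K' hK' K hK x hx' hx))
      (not_lt.1 (hlt K hK K' hK' x hx hx'))) hx hx'
  refine ⟨S, hdisj, fun K hK => hK.2.1, ?_, ?_, ?_⟩
  -- The volume bound divides by `o`. If `o = 0`, the integral over `J` vanishes and nothing is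
  -- selected.
  · rcases eq_or_ne o 0 with h0 | h0
    · have : IsEmpty S := by
        refine ⟨fun K => ?_⟩
        have h1 := K.2.2.2.1
        have h2 := (lintegral_mono_set (μ := volume) (f := fun y => ‖φ y - c‖ₑ) K.2.2.1).trans hJ
        rw [h0, zero_mul] at h2
        exact absurd (h1.trans_le h2) not_lt_zero
      simp
    · have h1 : o * (2 * ∑' K : S, volume (dyad K.1)) ≤ o * volume (dyad J) := by
        calc o * (2 * ∑' K : S, volume (dyad K.1))
            = ∑' K : S, 2 * o * volume (dyad K.1) := by rw [ENNReal.tsum_mul_left]; ring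
          _ ≤ ∑' K : S, ∫⁻ y in dyad K.1, ‖φ y - c‖ₑ :=
              ENNReal.tsum_le_tsum fun K => K.2.2.2.1.le
          _ = ∫⁻ y in ⋃ K ∈ S, dyad K, ‖φ y - c‖ₑ :=
              (lintegral_biUnion S.to_countable (fun K _ => measurableSet_dyad K) hdisj _).symm
          _ ≤ ∫⁻ y in dyad J, ‖φ y - c‖ₑ :=
              lintegral_mono_set (Set.iUnion₂_subset fun K hK => hK.2.1)
          _ ≤ _ := hJ
      exact (ENNReal.mul_le_mul_iff_right h0 ho).1 h1
  · intro K hK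
    have hp := dyadCenter_mem K
    have hsub : dyad K ⊆ dyad (dyadAt (K.1 - 1) (dyadCenter K)) :=
      dyad_subset_of_le (mem_dyadAt _ _) hp (by simp [dyadAt])
    have h1 := hK.2.2.2 (dyadAt (K.1 - 1) (dyadCenter K)) (Int.le_sub_one_of_lt hK.1)
      (Int.sub_one_lt_of_le le_rfl) hsub
    rw [volume_dyadAt_sub_one, dyadAt_eq hp] at h1
    calc _ ≤ _ := lintegral_mono_set hsub
      _ ≤ _ := h1
      _ = _ := by ring
  · filter_upwards [ae_enorm_sub_le_of_eventually_setLIntegral_dyad_le hφ c] with x hx hxJ hxS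
    refine hx _ ?_
    -- The first cube around `x` violating this bound would belong to `S`.
    have key : ∀ m : ℕ, ∫⁻ y in dyad (dyadAt (J.1 + m) x), ‖φ y - c‖ₑ ≤
        2 * o * volume (dyad (dyadAt (J.1 + m) x)) := by
      intro m
      induction m using Nat.strong_induction_on with
      | _ m ih =>
        by_contra hcon
        rcases Nat.eq_zero_or_pos m with hm | hm
        · apply hcon
          rw [hm, Nat.cast_zero, add_zero, dyadAt_eq hxJ]
          refine hJ.trans ?_
          gcongr
          rw [two_mul]; exact le_self_add
        · refine hxS (Set.mem_biUnion (x := dyadAt (J.1 + m) x) ?_ (mem_dyadAt _ _))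
          refine ⟨by simpa [dyadAt] using hm, dyad_subset_of_le hxJ (mem_dyadAt _ _)
            (by simp [dyadAt]), not_le.1 hcon, fun K' h1 h2 h3 => ?_⟩
          have hxK : x ∈ dyad K' := h3 (mem_dyadAt _ _)
          obtain ⟨d, hd⟩ := Int.le.dest h1
          have := ih d (by simp only [dyadAt] at h2; omega)
          rwa [hd, dyadAt_eq hxK] at this
    filter_upwards [Filter.eventually_ge_atTop J.1.toNat] with k hk
    obtain ⟨d, hd⟩ := Int.le.dest (show J.1 ≤ (k : ℤ) by omega)
    rw [← hd]
    exact key d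

theorem OscDominated.piOsc_dyad_le (hs : OscDominated V φ s) {J : ℤ × (Fin n → ℤ)}
    (hJ : dyad J ⊆ V) {x : Fin n → ℝ} (hx : x ∈ dyadBall J) : piOsc φ (dyad J) ≤ s x := by
  rw [piOsc_congr (dyad_ae_eq_dyadBall J)]
  exact hs _ _ (half_pos (dyadSide_pos J)) ((dyadBall_subset J).trans hJ) x hx

theorem setLAverage_dyad_le_ballMaximal (J : ℤ × (Fin n → ℤ)) {x : Fin n → ℝ}
    (hx : x ∈ dyadBall J) : (⨍⁻ y in dyad J, g y ∂volume) ≤ ballMaximal g x := by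
  rw [setLAverage_congr (dyad_ae_eq_dyadBall J)]
  exact laverage_le_ballMaximal g (half_pos (dyadSide_pos J)) hx

/-- At almost every point of `J`, the oscillation on `J` is at most `s` and the average of `g` over
`J` is at most its maximal function. Their product can thus be integrated over any `B` filling half
of `J` instead of over `J`. -/
theorem OscDominated.piOsc_mul_lintegral_le (hs : OscDominated V φ s) {J : ℤ × (Fin n → ℤ)}
    (hJ : dyad J ⊆ V) {B : Set (Fin n → ℝ)} (hB : MeasurableSet B) (hBJ : B ⊆ dyad J)
    (hvol : volume (dyad J) ≤ 2 * volume B) :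
    piOsc φ (dyad J) * ∫⁻ y in dyad J, g y ≤ 2 * ∫⁻ x in B, s x * ballMaximal g x := by
  have h0 := volume_dyad_ne_zero J
  have h1 := volume_dyad_ne_top J
  calc piOsc φ (dyad J) * ∫⁻ y in dyad J, g y
      = piOsc φ (dyad J) * ((⨍⁻ y in dyad J, g y ∂volume) * volume (dyad J)) := by
        rw [setLAverage_eq, ENNReal.div_mul_cancel h0 h1]
    _ ≤ piOsc φ (dyad J) * ((⨍⁻ y in dyad J, g y ∂volume) * (2 * volume B)) := by gcongr
    _ = 2 * ∫⁻ _ in B, piOsc φ (dyad J) * ⨍⁻ y in dyad J, g y ∂volume := by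
        rw [setLIntegral_const]; ring
    _ ≤ _ := by
        gcongr 1
        refine lintegral_mono_ae ((ae_restrict_iff' hB).2 ?_)
        filter_upwards [(dyad_ae_eq_dyadBall J).mem_iff] with x hx hxB
        have hx' := hx.1 (hBJ hxB)
        exact mul_le_mul' (hs.piOsc_dyad_le hJ hx') (setLAverage_dyad_le_ballMaximal J hx')

/-- One generation: off the stopping cubes `|φ - c| ≤ 2 * o`, and on a stopping cube the mean is
within `2 ^ n * (2 * o)` of `c`. What remains is the same integral on each stopping cube, and the
charge falls only on their complement. -/
theorem lintegral_osc_mul_step (hφ : Integrable φ) (hφm : Measurable φ)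
    (hg : Measurable g) (hs : OscDominated V φ s) {J : ℤ × (Fin n → ℤ)} (hJ : dyad J ⊆ V) :
    ∃ S : Set (ℤ × (Fin n → ℤ)), S.PairwiseDisjoint dyad ∧ (∀ K ∈ S, dyad K ⊆ dyad J) ∧
      2 * ∑' K : S, volume (dyad K.1) ≤ volume (dyad J) ∧
      ∫⁻ y in dyad J, ‖φ y - ⨍ z in dyad J, φ z‖ₑ * g y ≤
        2 ^ n * 4 * (∫⁻ x in dyad J \ ⋃ K ∈ S, dyad K, s x * ballMaximal g x) +
          ∑' K : S, ∫⁻ y in dyad K.1, ‖φ y - ⨍ z in dyad K.1, φ z‖ₑ * g y := by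
  have h0 := volume_dyad_ne_zero J
  have h1 := volume_dyad_ne_top J
  set c := ⨍ z in dyad J, φ z
  set o := piOsc φ (dyad J)
  obtain ⟨S, hdisj, hsub, hvol, hK, hae⟩ := exists_calderonZygmund hφ c J
    (piOsc_lt_top hφ h0 h1).ne (piOsc_mul_volume h0 h1).ge
  refine ⟨S, hdisj, hsub, hvol, ?_⟩
  set Ω := ⋃ K ∈ S, dyad K
  have hΩm : MeasurableSet Ω := MeasurableSet.biUnion S.to_countable fun K _ => measurableSet_dyad K
  have hΩJ : Ω ⊆ dyad J := Set.iUnion₂_subset hsub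
  have hBm : MeasurableSet (dyad J \ Ω) := (measurableSet_dyad J).diff hΩm
  have hΩ : 2 * volume Ω ≤ volume (dyad J) := by
    refine le_trans ?_ hvol
    gcongr
    exact measure_biUnion_le _ S.to_countable _
  have hB : volume (dyad J) ≤ 2 * volume (dyad J \ Ω) := by
    have h2 : volume (dyad J) = volume Ω + volume (dyad J \ Ω) := by
      rw [measure_sdiff hΩJ hΩm.nullMeasurableSet ((measure_mono hΩJ).trans_lt h1.lt_top).ne,
        add_tsub_cancel_of_le (measure_mono hΩJ)]
    refine (ENNReal.add_le_add_iff_left h1).1 ?_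
    calc volume (dyad J) + volume (dyad J) = 2 * volume Ω + 2 * volume (dyad J \ Ω) := by
          rw [← mul_add, ← h2, two_mul]
      _ ≤ _ := by gcongr
  have hsplit : ∀ f : (Fin n → ℝ) → ℝ≥0∞, ∫⁻ y in dyad J, f y =
      (∫⁻ y in dyad J \ Ω, f y) + ∑' K : S, ∫⁻ y in dyad K.1, f y := fun f => by
    rw [← lintegral_biUnion S.to_countable (fun K _ => measurableSet_dyad K) hdisj, add_comm,
      ← lintegral_inter_add_sdiff f (dyad J) hΩm, Set.inter_eq_self_of_subset_right hΩJ]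
  have hgood : ∫⁻ y in dyad J \ Ω, ‖φ y - c‖ₑ * g y ≤
      2 ^ n * (2 * o) * ∫⁻ y in dyad J \ Ω, g y := by
    rw [← lintegral_const_mul _ hg]
    refine lintegral_mono_ae ((ae_restrict_iff' hBm).2 ?_)
    filter_upwards [hae] with y hy hyB
    gcongr
    refine (hy hyB.1 hyB.2).trans ?_
    nth_rw 1 [← one_mul (2 * o)]
    gcongr
    exact one_le_pow₀ one_le_two
  have hbad : ∀ K : S, ∫⁻ y in dyad K.1, ‖φ y - c‖ₑ * g y ≤
      (∫⁻ y in dyad K.1, ‖φ y - ⨍ z in dyad K.1, φ z‖ₑ * g y) +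
        2 ^ n * (2 * o) * ∫⁻ y in dyad K.1, g y := by
    intro K
    rw [← lintegral_const_mul _ hg, ← lintegral_add_left (by fun_prop)]
    refine lintegral_mono fun y => ?_
    rw [← add_mul]
    gcongr
    have h2 : ‖(⨍ z in dyad K.1, φ z) - c‖ₑ ≤ 2 ^ n * (2 * o) :=
      (ENNReal.mul_le_mul_iff_left (volume_dyad_ne_zero K.1) (volume_dyad_ne_top K.1)).1
        ((enorm_setAverage_sub_mul_le hφ (volume_dyad_ne_zero K.1) (volume_dyad_ne_top K.1)
          c).trans (hK K.1 K.2))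
    calc ‖φ y - c‖ₑ = ‖(φ y - ⨍ z in dyad K.1, φ z) + ((⨍ z in dyad K.1, φ z) - c)‖ₑ := by
          rw [sub_add_sub_cancel]
      _ ≤ _ := (enorm_add_le _ _).trans (by gcongr)
  calc ∫⁻ y in dyad J, ‖φ y - c‖ₑ * g y
      = (∫⁻ y in dyad J \ Ω, ‖φ y - c‖ₑ * g y) +
          ∑' K : S, ∫⁻ y in dyad K.1, ‖φ y - c‖ₑ * g y := hsplit _
    _ ≤ 2 ^ n * (2 * o) * (∫⁻ y in dyad J \ Ω, g y) +
          ∑' K : S, ((∫⁻ y in dyad K.1, ‖φ y - ⨍ z in dyad K.1, φ z‖ₑ * g y) +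
            2 ^ n * (2 * o) * ∫⁻ y in dyad K.1, g y) :=
        add_le_add hgood (ENNReal.tsum_le_tsum hbad)
    _ = 2 ^ n * 2 * (o * ∫⁻ y in dyad J, g y) +
          ∑' K : S, ∫⁻ y in dyad K.1, ‖φ y - ⨍ z in dyad K.1, φ z‖ₑ * g y := by
        rw [ENNReal.tsum_add, ENNReal.tsum_mul_left, hsplit g]; ring
    _ ≤ 2 ^ n * 2 * (2 * ∫⁻ x in dyad J \ Ω, s x * ballMaximal g x) +
          ∑' K : S, ∫⁻ y in dyad K.1, ‖φ y - ⨍ z in dyad K.1, φ z‖ₑ * g y := by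
        gcongr 2
        exact hs.piOsc_mul_lintegral_le hJ hBm Set.sdiff_subset hB
    _ = _ := by ring

/-- After `k` generations the uncontrolled part lives on a set `E` of relative volume at most `2 ^
(-k)`. The coefficient of the main term does not grow with `k`, because the charged sets are
disjoint. -/
theorem lintegral_osc_mul_le_add (hφ : Integrable φ) (hφm : Measurable φ)
    (hg : Measurable g) {G : ℝ≥0} (hG : ∀ x, g x ≤ G) (hs : OscDominated V φ s) (k : ℕ) :
    ∀ J : ℤ × (Fin n → ℤ), dyad J ⊆ V → ∃ E ⊆ dyad J, MeasurableSet E ∧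
      2 ^ k * volume E ≤ volume (dyad J) ∧
      ∫⁻ y in dyad J, ‖φ y - ⨍ z in dyad J, φ z‖ₑ * g y ≤
        2 ^ n * 4 * (∫⁻ x in dyad J, s x * ballMaximal g x) + 2 * G * ∫⁻ y in E, ‖φ y‖ₑ := by
  induction k with
  | zero =>
    intro J hJ
    have h0 := volume_dyad_ne_zero J
    have h1 := volume_dyad_ne_top J
    refine ⟨dyad J, le_rfl, measurableSet_dyad J, by simp, le_trans ?_ le_add_self⟩
    calc ∫⁻ y in dyad J, ‖φ y - ⨍ z in dyad J, φ z‖ₑ * g y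
        ≤ ∫⁻ y in dyad J, (‖φ y‖ₑ + ‖⨍ z in dyad J, φ z‖ₑ) * G := by
          gcongr with y
          · exact enorm_sub_le
          · exact hG y
      _ = ((∫⁻ y in dyad J, ‖φ y‖ₑ) + ‖⨍ z in dyad J, φ z‖ₑ * volume (dyad J)) * G := by
          rw [lintegral_mul_const _ (by fun_prop), lintegral_add_right _ measurable_const,
            setLIntegral_const]
      _ ≤ ((∫⁻ y in dyad J, ‖φ y‖ₑ) + ∫⁻ y in dyad J, ‖φ y‖ₑ) * G := by
          gcongr
          simpa using enorm_setAverage_sub_mul_le hφ h0 h1 0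
      _ = _ := by ring
  | succ k ih =>
    intro J hJ
    obtain ⟨S, hdisj, hsub, hvol, hle⟩ := lintegral_osc_mul_step hφ hφm hg hs hJ
    choose! E hEK hEm hEvol hE using ih
    have hEdisj : S.PairwiseDisjoint E := fun K hK K' hK' hne =>
      (hdisj hK hK' hne).mono (hEK K ((hsub K hK).trans hJ)) (hEK K' ((hsub K' hK').trans hJ))
    have hEm' : ∀ K ∈ S, MeasurableSet (E K) := fun K hK => hEm K ((hsub K hK).trans hJ)
    have hΩm : MeasurableSet (⋃ K ∈ S, dyad K) :=
      MeasurableSet.biUnion S.to_countable fun K _ => measurableSet_dyad K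
    refine ⟨⋃ K ∈ S, E K, Set.iUnion₂_subset fun K hK =>
      (hEK K ((hsub K hK).trans hJ)).trans (hsub K hK),
      MeasurableSet.biUnion S.to_countable hEm', ?_, hle.trans ?_⟩
    · calc 2 ^ (k + 1) * volume (⋃ K ∈ S, E K)
          ≤ 2 ^ (k + 1) * ∑' K : S, volume (E K.1) := by
            gcongr; exact measure_biUnion_le _ S.to_countable _
        _ = 2 * ∑' K : S, 2 ^ k * volume (E K.1) := by rw [ENNReal.tsum_mul_left]; ring
        _ ≤ 2 * ∑' K : S, volume (dyad K.1) := by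
            gcongr with K; exact hEvol K.1 ((hsub K.1 K.2).trans hJ)
        _ ≤ _ := hvol
    · calc _ ≤ 2 ^ n * 4 * (∫⁻ x in dyad J \ ⋃ K ∈ S, dyad K, s x * ballMaximal g x) +
            ∑' K : S, (2 ^ n * 4 * (∫⁻ x in dyad K.1, s x * ballMaximal g x) +
              2 * G * ∫⁻ y in E K.1, ‖φ y‖ₑ) := by
            gcongr with K; exact hE K.1 ((hsub K.1 K.2).trans hJ)
        _ = _ := by
            rw [ENNReal.tsum_add, ENNReal.tsum_mul_left, ENNReal.tsum_mul_left,
              ← lintegral_biUnion S.to_countable hEm' hEdisj,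
              ← lintegral_biUnion S.to_countable (fun K _ => measurableSet_dyad K) hdisj,
              ← add_assoc, ← mul_add,
              ← lintegral_inter_add_sdiff (fun x => s x * ballMaximal g x) (dyad J) hΩm,
              Set.inter_eq_self_of_subset_right (Set.iUnion₂_subset hsub),
              add_comm (∫⁻ x in dyad J \ _, _)]

theorem lintegral_osc_mul_le (hφ : Integrable φ) (hφm : Measurable φ)
    (hg : Measurable g) {G : ℝ≥0} (hG : ∀ x, g x ≤ G) (hs : OscDominated V φ s)
    {J : ℤ × (Fin n → ℤ)} (hJ : dyad J ⊆ V) :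
    ∫⁻ y in dyad J, ‖φ y - ⨍ z in dyad J, φ z‖ₑ * g y ≤
      2 ^ n * 4 * ∫⁻ x in dyad J, s x * ballMaximal g x := by
  choose E hEJ hEm hEvol hE using fun k => lintegral_osc_mul_le_add hφ hφm hg hG hs k J hJ
  have hvol : Filter.Tendsto (volume ∘ E) Filter.atTop (nhds 0) := by
    have h2 : Filter.Tendsto (fun k : ℕ => volume (dyad J) * (2⁻¹ : ℝ≥0∞) ^ k) Filter.atTop
        (nhds 0) := by
      simpa using ENNReal.Tendsto.const_mul
        (ENNReal.tendsto_pow_atTop_nhds_zero_of_lt_one (by norm_num : (2⁻¹ : ℝ≥0∞) < 1))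
        (Or.inr (volume_dyad_ne_top J))
    refine tendsto_of_tendsto_of_tendsto_of_le_of_le tendsto_const_nhds h2 (fun _ => zero_le) ?_
    intro k
    simp only [Function.comp]
    rw [← ENNReal.inv_pow, ← div_eq_mul_inv, ENNReal.le_div_iff_mul_le (by simp) (by simp),
      mul_comm]
    exact hEvol k
  -- Absolute continuity of the integral removes the remainder; the bound `G` thereby disappears
  -- from the estimate.
  have hlim := tendsto_setLIntegral_zero (f := fun y => ‖φ y‖ₑ) hφ.hasFiniteIntegral.ne hvol
  have hlim2 := (ENNReal.Tendsto.const_mul (a := 2 * G) hlim (Or.inr (by finiteness))).const_add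
    (2 ^ n * 4 * ∫⁻ x in dyad J, s x * ballMaximal g x)
  rw [mul_zero, add_zero] at hlim2
  exact ge_of_tendsto' hlim2 hE

end local_estimate

/-! ### Whitney cubes and chains -/

/-- Every point of `V` can be joined to `x₀` by a connected set of points `y` of `V` whose distance
to the complement of `V` is comparable to or larger than the distance from the starting point. -/
def HasCarrots {X : Type*} [PseudoMetricSpace X] (V : Set X) (x₀ : X) : Prop :=
  ∃ A : ℝ, 0 < A ∧ ∀ x ∈ V, ∃ Γ ⊆ V, IsPreconnected Γ ∧ x ∈ Γ ∧ x₀ ∈ Γ ∧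
    ∀ y ∈ Γ, Metric.ball y (dist x y / A) ⊆ V

/-- A dyadic cube that is small compared with its distance to the complement of `V`. -/
def DyadDeep {n : ℕ} (V : Set (Fin n → ℝ)) (J : ℤ × (Fin n → ℤ)) : Prop :=
  ∀ y ∈ dyad J, 4 * dyadSide J ≤ Metric.infDist y Vᶜ

/-- The Whitney cubes of `V`: the maximal deep dyadic cubes. -/
def whitney {n : ℕ} (V : Set (Fin n → ℝ)) : Set (ℤ × (Fin n → ℤ)) :=
  {J | DyadDeep V J ∧ ∀ x ∈ dyad J, ¬ DyadDeep V (dyadAt (J.1 - 1) x)}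

/-- Two dyadic cubes are near if their distance is at most the smaller side. -/
def DyadNear {n : ℕ} (J K : ℤ × (Fin n → ℤ)) : Prop :=
  ∃ x ∈ dyad J, ∃ y ∈ dyad K, dist x y ≤ dyadSide J ∧ dist x y ≤ dyadSide K

section whitney

variable {n : ℕ} {φ : (Fin n → ℝ) → ℝ} {V : Set (Fin n → ℝ)} {s g : (Fin n → ℝ) → ℝ≥0∞}
  {J K : ℤ × (Fin n → ℤ)} {x y : Fin n → ℝ}

theorem infDist_compl_le_add_dist {X : Type*} [PseudoMetricSpace X] (V : Set X) (x y : X) :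
    Metric.infDist x Vᶜ ≤ Metric.infDist y Vᶜ + dist x y := Metric.infDist_le_infDist_add_dist

theorem infDist_compl_pos {X : Type*} [PseudoMetricSpace X] {V : Set X} (hV : IsOpen V)
    (hne : Vᶜ.Nonempty) {x : X} (hx : x ∈ V) : 0 < Metric.infDist x Vᶜ :=
  (hV.isClosed_compl.notMem_iff_infDist_pos hne).1 (Set.notMem_compl_iff.2 hx)

theorem ball_subset_of_le_infDist_compl {X : Type*} [PseudoMetricSpace X] {V : Set X} {x : X}
    {r : ℝ} (h : r ≤ Metric.infDist x Vᶜ) : Metric.ball x r ⊆ V :=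
  (Metric.ball_subset_ball h).trans Metric.ball_infDist_compl_subset

theorem le_infDist_compl_of_ball_subset {X : Type*} [PseudoMetricSpace X] {V : Set X}
    (hne : Vᶜ.Nonempty) {x : X} {r : ℝ} (h : Metric.ball x r ⊆ V) : r ≤ Metric.infDist x Vᶜ := by
  refine (Metric.le_infDist hne).2 fun y hy => ?_
  by_contra hc
  exact hy (h (by rw [Metric.mem_ball, dist_comm]; exact not_le.1 hc))

theorem DyadDeep.subset (h : DyadDeep V J) : dyad J ⊆ V := fun x hx =>
  ball_subset_of_le_infDist_compl (h x hx)
    (Metric.mem_ball_self (mul_pos four_pos (dyadSide_pos J)))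

theorem DyadDeep.mono (h : DyadDeep V J) (hx : x ∈ dyad J) (hx' : x ∈ dyad K) (hJK : J.1 ≤ K.1) :
    DyadDeep V K := fun y hy => by
  refine le_trans ?_ (h y (dyad_subset_of_le hx hx' hJK hy))
  have : dyadSide K ≤ dyadSide J := zpow_le_zpow_right₀ one_le_two (neg_le_neg hJK)
  linarith

/-- Small cubes around `x` are deep, and deep cubes have side bounded by the distance to the
complement, so there is a coarsest deep one. -/
theorem exists_mem_whitney (hV : IsOpen V) (hne : Vᶜ.Nonempty) (hx : x ∈ V) :
    ∃ J ∈ whitney V, x ∈ dyad J := by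
  have hd := infDist_compl_pos hV hne hx
  have hex : ∃ k : ℤ, DyadDeep V (dyadAt k x) := by
    obtain ⟨m, hm⟩ := exists_pow_lt_of_lt_one (y := (2⁻¹ : ℝ))
      (show 0 < Metric.infDist x Vᶜ / 5 by positivity) (by norm_num)
    refine ⟨m, fun y hy => ?_⟩
    have h1 := dist_le_dyadSide (mem_dyadAt (m : ℤ) x) hy
    have h2 := infDist_compl_le_add_dist V x y
    have h3 : dyadSide (dyadAt (m : ℤ) x) < Metric.infDist x Vᶜ / 5 := by
      rwa [dyadSide_dyadAt, zpow_neg, zpow_natCast, ← inv_pow]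
    linarith
  have hbdd : ∃ b : ℤ, ∀ k : ℤ, DyadDeep V (dyadAt k x) → b ≤ k := by
    obtain ⟨m, hm⟩ := pow_unbounded_of_one_lt (Metric.infDist x Vᶜ) (one_lt_two (α := ℝ))
    refine ⟨-m, fun k hk => ?_⟩
    by_contra hlt
    have h1 := hk x (mem_dyadAt k x)
    rw [dyadSide_dyadAt] at h1
    have h2 : (2 : ℝ) ^ (m : ℤ) ≤ 2 ^ (-k) := zpow_le_zpow_right₀ one_le_two (by omega)
    rw [zpow_natCast] at h2
    have : (0:ℝ) < 2 ^ (-k) := by positivity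
    linarith
  obtain ⟨k, hk, hmin⟩ := Int.exists_least_of_bdd hbdd hex
  refine ⟨dyadAt k x, ⟨hk, fun y hy hdeep => ?_⟩, mem_dyadAt k x⟩
  have hsub : dyad (dyadAt k x) ⊆ dyad (dyadAt (k - 1) y) :=
    dyad_subset_of_le (mem_dyadAt _ _) hy (by simp [dyadAt])
  have h1 := dyadAt_eq (hsub (mem_dyadAt k x))
  change DyadDeep V (dyadAt (k - 1) y) at hdeep
  rw [← h1] at hdeep
  have := hmin _ hdeep
  simp only [dyadAt] at this
  omega

theorem pairwiseDisjoint_whitney (V : Set (Fin n → ℝ)) : (whitney V).PairwiseDisjoint dyad := by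
  have hlt : ∀ J ∈ whitney V, ∀ K ∈ whitney V, ∀ x, x ∈ dyad J → x ∈ dyad K → ¬ J.1 < K.1 :=
    fun J hJ K hK x hx hx' hlt => hK.2 x hx' (hJ.1.mono hx (mem_dyadAt _ x)
      (Int.le_sub_one_of_lt hlt))
  intro J hJ K hK hJK
  refine Set.disjoint_left.2 fun x hx hx' => hJK ?_
  exact dyad_eq_or_disjoint_of_fst_eq (le_antisymm (not_lt.1 (hlt K hK J hJ x hx' hx))
    (not_lt.1 (hlt J hJ K hK x hx hx'))) hx hx'

theorem infDist_le_of_mem_whitney (hJ : J ∈ whitney V) (hx : x ∈ dyad J) :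
    Metric.infDist x Vᶜ ≤ 10 * dyadSide J := by
  -- The parent, of side `2 * dyadSide J`, is not deep: some point of it is closer than `8 *
  -- dyadSide J` to the complement and within `2 * dyadSide J` of `x`.
  have h := hJ.2 x hx
  simp only [DyadDeep, not_forall, not_le] at h
  obtain ⟨y, hy, hlt⟩ := h
  have hside : dyadSide (dyadAt (J.1 - 1) x) = 2 * dyadSide J := by
    rw [dyadSide_dyadAt, dyadSide, neg_sub, sub_eq_add_neg, zpow_add₀ two_ne_zero, zpow_one]
  rw [hside] at hlt
  have h1 := dist_le_dyadSide (mem_dyadAt (J.1 - 1) x) hy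
  rw [hside] at h1
  have := infDist_compl_le_add_dist V x y
  linarith

theorem biUnion_whitney (hV : IsOpen V) (hne : Vᶜ.Nonempty) : ⋃ J ∈ whitney V, dyad J = V := by
  refine subset_antisymm (Set.iUnion₂_subset fun J hJ => hJ.1.subset) fun x hx => ?_
  obtain ⟨J, hJ, hxJ⟩ := exists_mem_whitney hV hne hx
  exact Set.mem_biUnion hJ hxJ

theorem DyadNear.symm (h : DyadNear J K) : DyadNear K J := by
  obtain ⟨x, hx, y, hy, h1, h2⟩ := h
  exact ⟨y, hy, x, hx, by rwa [dist_comm], by rwa [dist_comm]⟩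

theorem DyadNear.exists_ball (hJ : J ∈ whitney V) (hK : K ∈ whitney V) (h : DyadNear J K) :
    ∃ z r, 0 < r ∧ Metric.ball z r ⊆ V ∧ dyad J ⊆ Metric.ball z r ∧ dyad K ⊆ Metric.ball z r ∧
      2 * r ≤ 17 * dyadSide J ∧ 2 * r ≤ 17 * dyadSide K := by
  wlog hle : dyadSide K ≤ dyadSide J generalizing J K
  · obtain ⟨z, r, h1, h2, h3, h4, h5, h6⟩ := this hK hJ h.symm (le_of_not_ge hle)
    exact ⟨z, r, h1, h2, h4, h3, h6, h5⟩
  obtain ⟨x, hx, y, hy, h1, h2⟩ := h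
  have hJ0 := dyadSide_pos J
  have h3 := hJ.1 x hx
  have h4 := infDist_le_of_mem_whitney hK hy
  have h5 := infDist_compl_le_add_dist V x y
  -- With `J` the larger cube, `4 * dyadSide J ≤ 10 * dyadSide K + dyadSide K`, so the diameter `6 *
  -- dyadSide J` is at most `16.5 * dyadSide K`; hence 17.
  refine ⟨x, 3 * dyadSide J, by positivity, ball_subset_of_le_infDist_compl (by linarith),
    fun w hw => ?_, fun w hw => ?_, by linarith, by linarith⟩
  · have := dist_le_dyadSide hw hx
    rw [Metric.mem_ball]; linarith
  · have h6 := dist_le_dyadSide hw hy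
    have h7 := dist_triangle w y x
    rw [dist_comm y x] at h7
    rw [Metric.mem_ball]; linarith

theorem enorm_setAverage_dyad_sub_ball_le (hφ : Integrable φ) {z : Fin n → ℝ} {r : ℝ} (hr : 0 < r)
    (hJ : dyad J ⊆ Metric.ball z r) (hrJ : 2 * r ≤ 17 * dyadSide J) :
    ‖(⨍ y in dyad J, φ y) - ⨍ y in Metric.ball z r, φ y‖ₑ ≤ 17 ^ n * piOsc φ (Metric.ball z r) := by
  have h0 := volume_dyad_ne_zero J
  have h1 := volume_dyad_ne_top J
  have hvol : volume (Metric.ball z r) ≤ 17 ^ n * volume (dyad J) := by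
    have := dyadSide_pos J
    rw [Real.volume_pi_ball _ hr, volume_dyad, Fintype.card_fin]
    calc ENNReal.ofReal ((2 * r) ^ n) ≤ ENNReal.ofReal ((17 * dyadSide J) ^ n) := by gcongr
      _ = _ := by
        rw [mul_pow, ENNReal.ofReal_mul (by positivity), ENNReal.ofReal_pow (by norm_num)]
        simp
  refine (ENNReal.mul_le_mul_iff_left h0 h1).1 ?_
  calc _ ≤ ∫⁻ y in dyad J, ‖φ y - ⨍ y in Metric.ball z r, φ y‖ₑ :=
        enorm_setAverage_sub_mul_le hφ h0 h1 _
    _ ≤ ∫⁻ y in Metric.ball z r, ‖φ y - ⨍ y in Metric.ball z r, φ y‖ₑ := lintegral_mono_set hJ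
    _ = piOsc φ (Metric.ball z r) * volume (Metric.ball z r) :=
        (piOsc_mul_volume (volume_ball_ne_zero z hr) (volume_ball_ne_top z r)).symm
    _ ≤ piOsc φ (Metric.ball z r) * (17 ^ n * volume (dyad J)) := by gcongr
    _ = _ := by ring

theorem DyadNear.enorm_setAverage_sub_le (hφ : Integrable φ) (hs : OscDominated V φ s)
    (hJ : J ∈ whitney V) (hK : K ∈ whitney V) (h : DyadNear J K) :
    ‖(⨍ y in dyad J, φ y) - ⨍ y in dyad K, φ y‖ₑ ≤ 2 * 17 ^ n * ⨅ x ∈ dyad J, s x := by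
  obtain ⟨z, r, hr, hV, hJz, hKz, hJr, hKr⟩ := h.exists_ball hJ hK
  have h1 := enorm_setAverage_dyad_sub_ball_le hφ hr hJz hJr
  have h2 := enorm_setAverage_dyad_sub_ball_le hφ hr hKz hKr
  have h3 : piOsc φ (Metric.ball z r) ≤ ⨅ x ∈ dyad J, s x :=
    le_iInf₂ fun x hx => hs z r hr hV x (hJz hx)
  rw [← sub_sub_sub_cancel_right _ _ (⨍ y in Metric.ball z r, φ y)]
  calc _ ≤ _ := enorm_sub_le
    _ ≤ 17 ^ n * piOsc φ (Metric.ball z r) + 17 ^ n * piOsc φ (Metric.ball z r) := add_le_add h1 h2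
    _ = 2 * 17 ^ n * piOsc φ (Metric.ball z r) := by ring
    _ ≤ _ := by gcongr

theorem eventually_dyadNear (hV : IsOpen V) (hne : Vᶜ.Nonempty) (hx : x ∈ V) :
    ∀ᶠ y in nhds x, ∀ J ∈ whitney V, ∀ K ∈ whitney V, x ∈ dyad J → y ∈ dyad K → DyadNear J K := by
  have hd := infDist_compl_pos hV hne hx
  filter_upwards [Metric.ball_mem_nhds x (show 0 < Metric.infDist x Vᶜ / 20 by positivity)]
    with y hy J hJ K hK hxJ hyK
  rw [Metric.mem_ball, dist_comm] at hy
  have h1 := infDist_le_of_mem_whitney hJ hxJ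
  have h2 := infDist_le_of_mem_whitney hK hyK
  have h3 := infDist_compl_le_add_dist V x y
  exact ⟨x, hxJ, y, hyK, by linarith, by linarith⟩

/-- The Whitney cubes that meet `Γ`. -/
def whitneyMeeting (V Γ : Set (Fin n → ℝ)) : Set (ℤ × (Fin n → ℤ)) :=
  {K | K ∈ whitney V ∧ (dyad K ∩ Γ).Nonempty}

/-- The graph of near Whitney cubes among those that meet `Γ`. -/
def whitneyGraph (V Γ : Set (Fin n → ℝ)) : SimpleGraph (whitneyMeeting V Γ) :=
  SimpleGraph.fromRel fun J K => DyadNear J.1 K.1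

/-- Nearby points of `Γ` lie in equal or near Whitney cubes, so reachability holds locally and
preconnectedness of `Γ` makes it global. -/
theorem whitneyGraph_reachable (hV : IsOpen V) (hne : Vᶜ.Nonempty) {Γ : Set (Fin n → ℝ)}
    (hΓV : Γ ⊆ V) (hΓ : IsPreconnected Γ) (hx : x ∈ Γ) (hy : y ∈ Γ) (hJ : J ∈ whitney V)
    (hK : K ∈ whitney V) (hxJ : x ∈ dyad J) (hyK : y ∈ dyad K) :
    (whitneyGraph V Γ).Reachable ⟨J, hJ, x, hxJ, hx⟩ ⟨K, hK, y, hyK, hy⟩ := by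
  have : PreconnectedSpace Γ := Subtype.preconnectedSpace hΓ
  choose w hw hwm using fun x : Γ => exists_mem_whitney hV hne (hΓV x.2)
  have heq : ∀ x : Γ, ∀ J, J ∈ whitney V → x.1 ∈ dyad J → w x = J := fun x J hJ hxJ => by
    by_contra hne
    exact Set.disjoint_left.1 (pairwiseDisjoint_whitney V (hw x) hJ hne) (hwm x) hxJ
  let v : Γ → whitneyMeeting V Γ := fun x => ⟨w x, hw x, x.1, hwm x, x.2⟩
  have hloc : ∀ x : Γ, ∀ᶠ y in nhds x, (whitneyGraph V Γ).Reachable (v x) (v y) := by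
    intro x
    filter_upwards [continuous_subtype_val.continuousAt.eventually
      (eventually_dyadNear hV hne (hΓV x.2))] with y hxy
    by_cases h : v x = v y
    · rw [h]
    · refine SimpleGraph.Adj.reachable ((SimpleGraph.fromRel_adj _ _ _).2 ⟨h, Or.inl ?_⟩)
      exact hxy _ (hw x) _ (hw y) (hwm x) (hwm y)
  have hmain := PreconnectedSpace.induction₂' (fun x y : Γ => (whitneyGraph V Γ).Reachable (v x) (v y))
    (fun x => (hloc x).mono fun y hy => ⟨hy, hy.symm⟩) ⟨fun _ _ _ h1 h2 => h1.trans h2⟩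
    ⟨x, hx⟩ ⟨y, hy⟩
  have h1 : v ⟨x, hx⟩ = ⟨J, hJ, x, hxJ, hx⟩ := Subtype.ext (heq _ J hJ hxJ)
  have h2 : v ⟨y, hy⟩ = ⟨K, hK, y, hyK, hy⟩ := Subtype.ext (heq _ K hK hyK)
  rwa [h1, h2] at hmain

theorem enorm_sub_le_sum_support (hφ : Integrable φ) (hs : OscDominated V φ s)
    {Γ : Set (Fin n → ℝ)} {J K : whitneyMeeting V Γ} (p : (whitneyGraph V Γ).Walk J K) :
    ‖(⨍ y in dyad J.1, φ y) - ⨍ y in dyad K.1, φ y‖ₑ ≤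
      2 * 17 ^ n * (p.support.map fun L => ⨅ x ∈ dyad L.1, s x).sum := by
  induction p with
  | nil => simp
  | @cons u v w h p ih =>
    have hnear : DyadNear u.1 v.1 := by
      rcases ((SimpleGraph.fromRel_adj _ _ _).1 h).2 with h | h
      · exact h
      · exact h.symm
    rw [SimpleGraph.Walk.support_cons, List.map_cons, List.sum_cons, mul_add,
      ← sub_add_sub_cancel _ (⨍ y in dyad v.1, φ y)]
    exact (enorm_add_le _ _).trans (add_le_add (hnear.enorm_setAverage_sub_le hφ hs u.2.1 v.2.1) ih)

/-- A path in the graph visits each cube at most once, so telescoping along it is bounded by the sum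
over all cubes meeting `Γ`. No control on the length of the chain is needed. -/
theorem enorm_sub_le_tsum_whitneyMeeting (hV : IsOpen V) (hne : Vᶜ.Nonempty) (hφ : Integrable φ)
    (hs : OscDominated V φ s) {Γ : Set (Fin n → ℝ)}
    (hΓV : Γ ⊆ V) (hΓ : IsPreconnected Γ) (hx : x ∈ Γ) (hy : y ∈ Γ) (hJ : J ∈ whitney V)
    (hK : K ∈ whitney V) (hxJ : x ∈ dyad J) (hyK : y ∈ dyad K) :
    ‖(⨍ y in dyad J, φ y) - ⨍ y in dyad K, φ y‖ₑ ≤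
      2 * 17 ^ n * ∑' L, (whitneyMeeting V Γ).indicator (fun L => ⨅ x ∈ dyad L, s x) L := by
  classical
  obtain ⟨p, hp⟩ := (whitneyGraph_reachable hV hne hΓV hΓ hx hy hJ hK hxJ hyK).exists_isPath
  refine (enorm_sub_le_sum_support hφ hs p).trans ?_
  rw [← tsum_subtype, ← List.sum_toFinset _ hp.support_nodup]
  gcongr
  exact ENNReal.sum_le_tsum (f := fun L : whitneyMeeting V Γ => ⨅ x ∈ dyad L.1, s x) _

/-- Every point of `K` lies in the dilated ball, so the average of `g` over it is below the maximal
function throughout `K`; `(2 * R) ^ n` is the ratio of the volumes. -/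
theorem iInf_mul_setLIntegral_le {R : ℝ} (hR : 1 ≤ R) (s g : (Fin n → ℝ) → ℝ≥0∞) :
    (⨅ x ∈ dyad K, s x) * ∫⁻ y in Metric.ball (dyadCenter K) (R * dyadSide K), g y ≤
      ENNReal.ofReal ((2 * R) ^ n) * ∫⁻ x in dyad K, s x * ballMaximal g x := by
  have hK := dyadSide_pos K
  have hr : 0 < R * dyadSide K := by positivity
  set B := Metric.ball (dyadCenter K) (R * dyadSide K)
  have hKB : dyad K ⊆ B := fun x hx => by
    have := dyad_subset_closedBall K hx
    rw [Metric.mem_closedBall] at this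
    rw [Metric.mem_ball]
    nlinarith
  have hvol : volume B = ENNReal.ofReal ((2 * R) ^ n) * volume (dyad K) := by
    rw [Real.volume_pi_ball _ hr, volume_dyad, Fintype.card_fin, ← mul_assoc, mul_pow,
      ENNReal.ofReal_mul (by positivity)]
  calc (⨅ x ∈ dyad K, s x) * ∫⁻ y in B, g y
      = (⨅ x ∈ dyad K, s x) * ((⨍⁻ y in B, g y ∂volume) * volume B) := by
        rw [setLAverage_eq, ENNReal.div_mul_cancel (volume_ball_ne_zero _ hr)
          (volume_ball_ne_top _ _)]
    _ = ENNReal.ofReal ((2 * R) ^ n) *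
          ∫⁻ _ in dyad K, (⨅ x ∈ dyad K, s x) * ⨍⁻ y in B, g y ∂volume := by
        rw [hvol, setLIntegral_const]; ring
    _ ≤ _ := by
        gcongr 1
        refine setLIntegral_mono' (measurableSet_dyad K) fun x hx => ?_
        exact mul_le_mul' (iInf₂_le x hx) (laverage_le_ballMaximal g hr (hKB hx))

theorem exists_lintegral_enorm_sub_mul_le (hV : IsOpen V) (hne : Vᶜ.Nonempty) {x₀ : Fin n → ℝ}
    (hx₀ : x₀ ∈ V) (hc : HasCarrots V x₀) :
    ∃ (C : ℝ≥0) (J₀ : ℤ × (Fin n → ℤ)), ∀ (φ : (Fin n → ℝ) → ℝ) (s g : (Fin n → ℝ) → ℝ≥0∞)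
      (G : ℝ≥0), Integrable φ → Measurable φ → OscDominated V φ s → Measurable g →
      (∀ x, g x ≤ G) → ∫⁻ x in V, ‖φ x - ⨍ y in dyad J₀, φ y‖ₑ * g x ≤
        C * ∫⁻ x in V, s x * ballMaximal g x := by
  obtain ⟨A, hA, hcar⟩ := hc
  obtain ⟨J₀, hJ₀, hx₀J⟩ := exists_mem_whitney hV hne hx₀
  -- For `y` in `K` on the set joining the centre of `J` to `x₀`, that centre is within `10 * A *
  -- dyadSide K` of `y`. Hence `dyadSide J ≤ 2.5 * (1 + A) * dyadSide K`, and `J` lies within `(3.5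
  -- + 12.5 * A) * dyadSide K` of the centre of `K`.
  set R : ℝ := 5 + 13 * A with hRdef
  refine ⟨(2 ^ n * 4 + 2 * 17 ^ n * ((2 * R) ^ n).toNNReal : ℝ≥0), J₀, ?_⟩
  intro φ s g G hφ hφm hs hg hG
  set c := ⨍ y in dyad J₀, φ y
  choose! Γ hΓV hΓ hxΓ hx₀Γ hΓA using hcar
  set T : ℤ × (Fin n → ℤ) → Set (ℤ × (Fin n → ℤ)) :=
    fun J => whitneyMeeting V (Γ (dyadCenter J)) with hT
  have hctr : ∀ J ∈ whitney V, dyadCenter J ∈ V := fun J hJ => hJ.1.subset (dyadCenter_mem J)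
  have hshadow : ∀ J ∈ whitney V, ∀ K ∈ T J,
      dyad J ⊆ Metric.ball (dyadCenter K) (R * dyadSide K) := by
    rintro J hJ K ⟨hK, y, hyK, hyΓ⟩ z hz
    have hJV := hctr J hJ
    have h1 := le_infDist_compl_of_ball_subset hne (hΓA _ hJV y hyΓ)
    rw [div_le_iff₀' hA] at h1
    have h2 := infDist_le_of_mem_whitney hK hyK
    have h3 := infDist_compl_le_add_dist V (dyadCenter J) y
    have h4 := hJ.1 _ (dyadCenter_mem J)
    have h5 := dist_le_dyadSide hz (dyadCenter_mem J)
    have h6 := dist_le_dyadSide hyK (dyadCenter_mem K)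
    have h7 := dist_triangle4 z (dyadCenter J) y (dyadCenter K)
    have h8 : A * Metric.infDist y Vᶜ ≤ A * (10 * dyadSide K) := by gcongr
    have hK0 := dyadSide_pos K
    have h9 : 0 < A * dyadSide K := by positivity
    rw [Metric.mem_ball, hRdef]
    linarith
  have hterm : ∀ J : whitney V, ∫⁻ x in dyad J.1, ‖φ x - c‖ₑ * g x ≤
      2 ^ n * 4 * (∫⁻ x in dyad J.1, s x * ballMaximal g x) +
        2 * 17 ^ n * ((∑' L, (T J.1).indicator (fun L => ⨅ x ∈ dyad L, s x) L) *
          ∫⁻ x in dyad J.1, g x) := by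
    intro J
    have h1 := enorm_sub_le_tsum_whitneyMeeting hV hne hφ hs (hΓV _ (hctr J.1 J.2))
      (hΓ _ (hctr J.1 J.2)) (hxΓ _ (hctr J.1 J.2)) (hx₀Γ _ (hctr J.1 J.2)) J.2 hJ₀
      (dyadCenter_mem J.1) hx₀J
    calc ∫⁻ x in dyad J.1, ‖φ x - c‖ₑ * g x
        ≤ ∫⁻ x in dyad J.1, (‖φ x - ⨍ y in dyad J.1, φ y‖ₑ * g x +
            ‖(⨍ y in dyad J.1, φ y) - c‖ₑ * g x) := by
          refine lintegral_mono fun x => ?_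
          rw [← add_mul, ← sub_add_sub_cancel (φ x) (⨍ y in dyad J.1, φ y) c]
          gcongr
          exact enorm_add_le _ _
      _ = (∫⁻ x in dyad J.1, ‖φ x - ⨍ y in dyad J.1, φ y‖ₑ * g x) +
            ‖(⨍ y in dyad J.1, φ y) - c‖ₑ * ∫⁻ x in dyad J.1, g x := by
          rw [lintegral_add_left (by fun_prop), lintegral_const_mul _ hg]
      _ ≤ _ := by
          refine add_le_add (lintegral_osc_mul_le hφ hφm hg hG hs J.2.1.subset) ?_
          rw [← mul_assoc]
          gcongr
  have hsum : ∀ f : (Fin n → ℝ) → ℝ≥0∞,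
      ∫⁻ x in V, f x = ∑' J : whitney V, ∫⁻ x in dyad J.1, f x := fun f => by
    rw [← lintegral_biUnion (whitney V).to_countable (fun K _ => measurableSet_dyad K)
      (pairwiseDisjoint_whitney V), biUnion_whitney hV hne]
  -- After the interchange of sums, the disjoint cubes `J` whose chain passes through `K` all lie in
  -- the dilate of `K`.
  have hK : ∀ K, ∑' J : whitney V, (T J.1).indicator (fun L => ⨅ x ∈ dyad L, s x) K *
      ∫⁻ x in dyad J.1, g x ≤ (whitney V).indicator
        (fun K => ENNReal.ofReal ((2 * R) ^ n) * ∫⁻ x in dyad K, s x * ballMaximal g x) K := by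
    intro K
    by_cases hKW : K ∈ whitney V
    · rw [Set.indicator_of_mem hKW]
      set B := Metric.ball (dyadCenter K) (R * dyadSide K)
      calc _ ≤ ∑' J : whitney V, (⨅ x ∈ dyad K, s x) * ∫⁻ x in dyad J.1, B.indicator g x := by
            refine ENNReal.tsum_le_tsum fun J => ?_
            by_cases hKT : K ∈ T J.1
            · rw [Set.indicator_of_mem hKT]
              gcongr 1
              refine setLIntegral_mono' (measurableSet_dyad _) fun x hx => ?_
              rw [Set.indicator_of_mem (hshadow J.1 J.2 K hKT hx)]
            · rw [Set.indicator_of_notMem hKT, zero_mul]; exact zero_le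
        _ = (⨅ x ∈ dyad K, s x) * ∫⁻ x in V, B.indicator g x := by
            rw [ENNReal.tsum_mul_left, ← hsum]
        _ ≤ (⨅ x ∈ dyad K, s x) * ∫⁻ x, B.indicator g x := by
            gcongr 1; exact setLIntegral_le_lintegral _ _
        _ ≤ _ := by
            rw [lintegral_indicator Metric.isOpen_ball.measurableSet]
            exact iInf_mul_setLIntegral_le (by linarith) s g
    · rw [Set.indicator_of_notMem hKW]
      refine (ENNReal.tsum_eq_zero.2 fun J => ?_).le
      rw [Set.indicator_of_notMem (fun h => hKW h.1), zero_mul]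
  calc ∫⁻ x in V, ‖φ x - c‖ₑ * g x = ∑' J : whitney V, ∫⁻ x in dyad J.1, ‖φ x - c‖ₑ * g x := hsum _
    _ ≤ _ := ENNReal.tsum_le_tsum hterm
    _ = 2 ^ n * 4 * (∫⁻ x in V, s x * ballMaximal g x) + 2 * 17 ^ n *
          ∑' K, ∑' J : whitney V, (T J.1).indicator (fun L => ⨅ x ∈ dyad L, s x) K *
            ∫⁻ x in dyad J.1, g x := by
        rw [ENNReal.tsum_add, ENNReal.tsum_mul_left, ENNReal.tsum_mul_left, ← hsum,
          ENNReal.tsum_comm]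
        simp_rw [ENNReal.tsum_mul_right]
    _ ≤ 2 ^ n * 4 * (∫⁻ x in V, s x * ballMaximal g x) + 2 * 17 ^ n *
          (ENNReal.ofReal ((2 * R) ^ n) * ∫⁻ x in V, s x * ballMaximal g x) := by
        gcongr 2
        refine (ENNReal.tsum_le_tsum hK).trans (le_of_eq ?_)
        rw [← tsum_subtype, ENNReal.tsum_mul_left, ← hsum]
    _ = _ := by
        push_cast
        rw [ENNReal.ofReal]; ring

end whitney

/-! ### The `L^q` estimate by duality -/

theorem ENNReal.le_rpow_mul_of_le_mul_rpow {q p : ℝ} (hpq : q.HolderConjugate p) {I K S : ℝ≥0∞}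
    (hI : I ≠ ⊤) (h : I ≤ K * S ^ (1 / q) * I ^ (1 / p)) : I ≤ K ^ q * S := by
  rcases eq_or_ne I 0 with h0 | h0
  · rw [h0]; exact zero_le
  have hq := hpq.pos
  have h1 : I ^ (1 / q) ≤ K * S ^ (1 / q) := by
    have hI0 : I ^ (1 / p) ≠ 0 := by simp [ENNReal.rpow_eq_zero_iff, h0, hI]
    have hI1 : I ^ (1 / p) ≠ ⊤ := ENNReal.rpow_ne_top_of_nonneg hpq.symm.one_div_nonneg hI
    refine (ENNReal.mul_le_mul_iff_left hI0 hI1).1 ?_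
    rwa [← ENNReal.rpow_add _ _ h0 hI, one_div, one_div, hpq.inv_add_inv_eq_one, ENNReal.rpow_one,
      ← one_div, ← one_div]
  calc I = (I ^ (1 / q)) ^ q := by
        rw [← ENNReal.rpow_mul, one_div_mul_cancel hq.ne', ENNReal.rpow_one]
    _ ≤ (K * S ^ (1 / q)) ^ q := by gcongr
    _ = _ := by
        rw [ENNReal.mul_rpow_of_nonneg _ _ hq.le, ← ENNReal.rpow_mul, one_div_mul_cancel hq.ne',
          ENNReal.rpow_one]

theorem exists_lintegral_enorm_sub_rpow_le {n : ℕ} (hn : 0 < n) {q : ℝ} (hq : 1 < q)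
    {V : Set (Fin n → ℝ)} (hV : IsOpen V) (hne : Vᶜ.Nonempty) (hvol : volume V ≠ ⊤)
    {x₀ : Fin n → ℝ} (hx₀ : x₀ ∈ V) (hc : HasCarrots V x₀) :
    ∃ C : ℝ≥0, ∀ (φ : (Fin n → ℝ) → ℝ) (s : (Fin n → ℝ) → ℝ≥0∞),
      Integrable φ → Measurable φ → OscDominated V φ s → AEMeasurable s (volume.restrict V) →
      ∃ c : ℝ, ∫⁻ x in V, ‖φ x - c‖ₑ ^ q ≤ C * ∫⁻ x in V, s x ^ q := by
  obtain ⟨C₁, J₀, hC₁⟩ := exists_lintegral_enorm_sub_mul_le hV hne hx₀ hc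
  set p : ℝ := q.conjExponent
  have hpq : q.HolderConjugate p := Real.HolderConjugate.conjExponent hq
  have hp1 : 1 < p := hpq.symm.lt
  have hq0 : 0 < q := hpq.pos
  have hqp : (q - 1) * p = q := by have := hpq.sub_one_mul_conj; linarith
  have hq1 : 0 < q - 1 := by linarith
  set C₂ : ℝ≥0 := (p * (2 * 5 ^ n) * (2 ^ (p - 1) / (p - 1))).toNNReal with hC₂
  set K : ℝ≥0 := C₁ * C₂ ^ (1 / p)
  refine ⟨K ^ q, fun φ s hφ hφm hs hsm => ⟨⨍ y in dyad J₀, φ y, ?_⟩⟩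
  set c := ⨍ y in dyad J₀, φ y
  set h : (Fin n → ℝ) → ℝ≥0∞ := fun x => ‖φ x - c‖ₑ
  have hhm : Measurable h := by fun_prop
  have htrunc : ∀ N : ℕ, ∫⁻ x in V, (min (h x) N) ^ q ≤ (K ^ q : ℝ≥0) * ∫⁻ x in V, s x ^ q := by
    intro N
    set m : (Fin n → ℝ) → ℝ≥0∞ := fun x => min (h x) N
    have hmm : Measurable m := hhm.min measurable_const
    -- The extremal function for duality, since `(q - 1) * p = q`. Truncation at `N` makes `g`
    -- bounded and the integral of `m ^ q` finite, as the absorption requires.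
    set g : (Fin n → ℝ) → ℝ≥0∞ := V.indicator fun x => m x ^ (q - 1)
    have hgm : Measurable g := (hmm.pow_const _).indicator hV.measurableSet
    have hgG : ∀ x, g x ≤ ((N : ℝ≥0) ^ (q - 1) : ℝ≥0) := fun x => by
      refine (Set.indicator_le_self _ _ x).trans ?_
      rw [ENNReal.coe_rpow_of_nonneg _ hq1.le]
      gcongr
      exact min_le_right _ _
    have hI : ∫⁻ x in V, m x ^ q ≠ ⊤ := by
      refine ((setLIntegral_mono' (g := fun _ => (N : ℝ≥0∞) ^ q) hV.measurableSet
        fun x _ => ?_).trans_lt ?_).ne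
      · gcongr; exact min_le_right _ _
      · rw [setLIntegral_const]
        exact ENNReal.mul_lt_top (ENNReal.rpow_lt_top_of_nonneg hq0.le (by simp)) hvol.lt_top
    have hgp : ∫⁻ x, g x ^ p = ∫⁻ x in V, m x ^ q := by
      rw [← lintegral_indicator hV.measurableSet]
      refine lintegral_congr fun x => ?_
      by_cases hx : x ∈ V
      · simp only [g, Set.indicator_of_mem hx]; rw [← ENNReal.rpow_mul, hqp]
      · simp only [g, Set.indicator_of_notMem hx]; rw [ENNReal.zero_rpow_of_pos (by linarith)]
    have hM : ∫⁻ x in V, ballMaximal g x ^ p ≤ C₂ * ∫⁻ x in V, m x ^ q := by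
      rw [← hgp]
      exact (setLIntegral_le_lintegral _ _).trans (lintegral_ballMaximal_rpow_le hn hp1 hgm hgG)
    rw [ENNReal.coe_rpow_of_nonneg _ hq0.le]
    refine ENNReal.le_rpow_mul_of_le_mul_rpow hpq hI ?_
    calc ∫⁻ x in V, m x ^ q ≤ ∫⁻ x in V, h x * g x := by
          refine setLIntegral_mono' hV.measurableSet fun x hx => ?_
          simp only [g, Set.indicator_of_mem hx]
          calc m x ^ q = m x * m x ^ (q - 1) := by
                nth_rw 2 [← ENNReal.rpow_one (m x)]
                rw [← ENNReal.rpow_add_of_nonneg _ _ zero_le_one hq1.le, add_sub_cancel]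
            _ ≤ _ := by gcongr; exact min_le_left _ _
      _ ≤ C₁ * ∫⁻ x in V, s x * ballMaximal g x := hC₁ φ s g _ hφ hφm hs hgm hgG
      _ ≤ C₁ * ((∫⁻ x in V, s x ^ q) ^ (1 / q) *
            (∫⁻ x in V, ballMaximal g x ^ p) ^ (1 / p)) := by
          gcongr
          exact ENNReal.lintegral_mul_le_Lp_mul_Lq _ hpq hsm (measurable_ballMaximal g).aemeasurable
      _ ≤ C₁ * ((∫⁻ x in V, s x ^ q) ^ (1 / q) * (C₂ * ∫⁻ x in V, m x ^ q) ^ (1 / p)) := by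
          have := hpq.symm.one_div_nonneg
          gcongr
      _ = _ := by
          rw [ENNReal.mul_rpow_of_nonneg _ _ hpq.symm.one_div_nonneg, ENNReal.coe_mul,
            ENNReal.coe_rpow_of_nonneg _ hpq.symm.one_div_nonneg]
          ring
  refine le_of_tendsto' (lintegral_tendsto_of_tendsto_of_monotone
    (fun N : ℕ => ((hhm.min measurable_const).pow_const q).aemeasurable) ?_ ?_) htrunc
  · refine .of_forall fun x N M hNM => ?_
    dsimp only
    gcongr
  · refine .of_forall fun x => ?_
    obtain ⟨N, hN⟩ := ENNReal.exists_nat_gt (enorm_ne_top (x := φ x - c))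
    refine tendsto_const_nhds.congr' ?_
    filter_upwards [Filter.eventually_ge_atTop N] with M hM
    rw [min_eq_left]
    exact hN.le.trans (by gcongr)

/-! ### John domains and Lipschitz domains have carrots -/

/-- A ball is connected, so it cannot leave `U` without meeting the frontier. -/
theorem ball_subset_of_le_infDist_frontier {E : Type*} [SeminormedAddCommGroup E] [NormedSpace ℝ E]
    {U : Set E} (hU : IsOpen U) {x : E} (hx : x ∈ U) {r : ℝ}
    (hr : r ≤ Metric.infDist x (frontier U)) : Metric.ball x r ⊆ U := by
  rcases le_or_gt r 0 with hr0 | hr0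
  · rw [Metric.ball_eq_empty.2 hr0]; exact Set.empty_subset _
  refine IsPreconnected.subset_left_of_subset_union hU isClosed_closure.isOpen_compl
    (Set.disjoint_compl_right_iff_subset.2 subset_closure) (fun y hy => ?_)
    ⟨x, Metric.mem_ball_self hr0, hx⟩ (convex_ball x r).isPreconnected
  by_contra hc
  simp only [Set.mem_union, Set.mem_compl_iff, not_or, not_not] at hc
  have hyf : y ∈ frontier U := by rw [hU.frontier_eq]; exact ⟨hc.2, hc.1⟩
  have := Metric.infDist_le_dist_of_mem (x := x) hyf
  rw [Metric.mem_ball, dist_comm] at hy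
  linarith

theorem HasUnitSpeedOn.dist_le {E : Type*} [PseudoMetricSpace E] {γ : ℝ → E} {l : ℝ}
    (h : HasUnitSpeedOn γ (Set.Icc 0 l)) {s t : ℝ} (hs : s ∈ Set.Icc 0 l) (ht : t ∈ Set.Icc 0 l)
    (hst : s ≤ t) : dist (γ s) (γ t) ≤ t - s := by
  have h1 := h hs ht
  have h2 : edist (γ s) (γ t) ≤ eVariationOn γ (Set.Icc 0 l ∩ Set.Icc s t) :=
    eVariationOn.edist_le _ ⟨hs, le_rfl, hst⟩ ⟨ht, hst, le_rfl⟩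
  rw [h1, NNReal.coe_one, one_mul, edist_dist,
    ENNReal.ofReal_le_ofReal_iff (sub_nonneg.2 hst)] at h2
  exact h2

theorem HasUnitSpeedOn.continuousOn {E : Type*} [PseudoMetricSpace E] {γ : ℝ → E} {l : ℝ}
    (h : HasUnitSpeedOn γ (Set.Icc 0 l)) : ContinuousOn γ (Set.Icc 0 l) := by
  refine (LipschitzOnWith.of_dist_le_mul (K := 1) fun s hs t ht => ?_).continuousOn
  rw [NNReal.coe_one, one_mul, Real.dist_eq]
  rcases le_total s t with hst | hst
  · rw [abs_sub_comm]
    exact (h.dist_le hs ht hst).trans (le_abs_self _)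
  · rw [dist_comm]
    exact (h.dist_le ht hs hst).trans (le_abs_self _)

theorem IsJohnDomain.exists_hasCarrots {n : ℕ} {U : Set (Rn n)} (hU : IsJohnDomain U) :
    ∃ x₀ ∈ U, HasCarrots U x₀ := by
  obtain ⟨x₀, hx₀, α, hα, h⟩ := hU.exists_center
  refine ⟨x₀, hx₀, α, hα, fun x hx => ?_⟩
  obtain ⟨l, γ, hl, hγ, h0, h1, hγU⟩ := h x hx
  refine ⟨γ '' Set.Icc 0 l, ?_, isPreconnected_Icc.image _ hγ.continuousOn,
    ⟨0, ⟨le_rfl, hl⟩, h0⟩, ⟨l, ⟨hl, le_rfl⟩, h1⟩, ?_⟩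
  · rintro _ ⟨t, ht, rfl⟩
    exact (hγU t ht).1
  · rintro _ ⟨t, ht, rfl⟩
    refine ball_subset_of_le_infDist_frontier hU.isOpen (hγU t ht).1 (le_trans ?_ (hγU t ht).2)
    have := hγ.dist_le ⟨le_rfl, hl⟩ ht ht.1
    rw [h0, sub_zero] at this
    gcongr

/-- The carrot condition for the starting points in `S ∩ U`. -/
def HasCarrotsFrom {X : Type*} [PseudoMetricSpace X] (U : Set X) (x₀ : X) (S : Set X) : Prop :=
  ∃ A : ℝ, 0 < A ∧ ∀ x ∈ S ∩ U, ∃ Γ ⊆ U, IsPreconnected Γ ∧ x ∈ Γ ∧ x₀ ∈ Γ ∧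
    ∀ y ∈ Γ, Metric.ball y (dist x y / A) ⊆ U

section carrots

variable {X : Type*} [PseudoMetricSpace X] {U S T : Set X} {x₀ : X}

theorem HasCarrotsFrom.mono (h : HasCarrotsFrom U x₀ T) (hST : S ⊆ T) : HasCarrotsFrom U x₀ S := by
  obtain ⟨A, hA, h⟩ := h
  exact ⟨A, hA, fun x hx => h x ⟨hST hx.1, hx.2⟩⟩

theorem HasCarrotsFrom.union (hS : HasCarrotsFrom U x₀ S) (hT : HasCarrotsFrom U x₀ T) :
    HasCarrotsFrom U x₀ (S ∪ T) := by
  obtain ⟨A, hA, hS⟩ := hS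
  obtain ⟨B, hB, hT⟩ := hT
  refine ⟨max A B, lt_max_of_lt_left hA, ?_⟩
  rintro x ⟨hx | hx, hxU⟩
  · obtain ⟨Γ, h1, h2, h3, h4, h5⟩ := hS x ⟨hx, hxU⟩
    refine ⟨Γ, h1, h2, h3, h4, fun y hy => (Metric.ball_subset_ball ?_).trans (h5 y hy)⟩
    gcongr
    exact le_max_left _ _
  · obtain ⟨Γ, h1, h2, h3, h4, h5⟩ := hT x ⟨hx, hxU⟩
    refine ⟨Γ, h1, h2, h3, h4, fun y hy => (Metric.ball_subset_ball ?_).trans (h5 y hy)⟩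
    gcongr
    exact le_max_right _ _

theorem hasCarrotsFrom_of_isCompact {K : Set X} (hK : IsCompact K)
    (h : ∀ x ∈ K, ∃ t ∈ nhds x, HasCarrotsFrom U x₀ t) : HasCarrotsFrom U x₀ K := by
  refine hK.induction_on ⟨1, one_pos, fun x hx => absurd hx.1 (Set.notMem_empty x)⟩
    (fun _ _ h1 h2 => h2.mono h1) (fun _ _ h1 h2 => h1.union h2) fun x hx => ?_
  obtain ⟨t, ht, htc⟩ := h x hx
  exact ⟨t, mem_nhdsWithin_of_mem_nhds ht, htc⟩

/-- One compact set, a closed ball joined to a path, serves all nearby starting points. Its distance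
to the complement is bounded below, while all distances inside `U` are at most the diameter. -/
theorem exists_nhds_hasCarrotsFrom_of_mem {E : Type*} [NormedAddCommGroup E] [NormedSpace ℝ E]
    [ProperSpace E] {U : Set E} (hU : IsOpen U) (hconn : IsConnected U)
    (hb : Bornology.IsBounded U) {x₀ x : E} (hx₀ : x₀ ∈ U) (hx : x ∈ U) :
    ∃ t ∈ nhds x, HasCarrotsFrom U x₀ t := by
  obtain ⟨ε, hε, hεU⟩ := Metric.nhds_basis_closedBall.mem_iff.1 (hU.mem_nhds hx)
  have hj := (hU.isConnected_iff_isPathConnected.1 hconn).joinedIn x hx x₀ hx₀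
  set γ := hj.somePath
  set Γ := Metric.closedBall x ε ∪ Set.range γ
  have hxball : x ∈ Metric.closedBall x ε := Metric.mem_closedBall_self hε.le
  have hΓU : Γ ⊆ U := Set.union_subset hεU (Set.range_subset_iff.2 hj.somePath_mem)
  have hΓc : IsCompact Γ := (isCompact_closedBall x ε).union (isCompact_range γ.continuous)
  have hΓp : IsPreconnected Γ := IsPreconnected.union x hxball ⟨0, γ.source⟩
    (convex_closedBall x ε).isPreconnected (isPreconnected_range γ.continuous)
  obtain ⟨m, hm, hmU⟩ := hΓc.exists_thickening_subset_open hU hΓU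
  have hD : 0 < Metric.diam U + 1 := by have := Metric.diam_nonneg (s := U); linarith
  refine ⟨Metric.ball x ε, Metric.ball_mem_nhds x hε, (Metric.diam U + 1) / m, by positivity,
    fun y hy => ⟨Γ, hΓU, hΓp, Or.inl (Metric.ball_subset_closedBall hy.1),
      Or.inr ⟨1, γ.target⟩, fun z hz => ?_⟩⟩
  have h1 : dist y z ≤ Metric.diam U := Metric.dist_le_diam_of_mem hb hy.2 (hΓU hz)
  refine (Metric.ball_subset_ball ?_).trans ((Metric.ball_subset_thickening hz m).trans hmU)
  rw [div_div_eq_mul_div, div_le_iff₀ hD]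
  nlinarith

/-- Interior cone property: raising `y` by `s` and then perturbing by `ρ` gains at least `s - ρ` in
height while the graph rises by at most `L * ρ`, which is safe when `(L + 1) * ρ < s`. The bounds by
`r / 4` keep all points in the chart. -/
theorem ball_add_smul_subset_of_graph {E : Type*} [NormedAddCommGroup E] [InnerProductSpace ℝ E]
    {U : Set E} {x ν : E} (hν : ‖ν‖ = 1) {L : ℝ≥0} {g : (ℝ ∙ ν)ᗮ → ℝ}
    (hg : LipschitzWith L g) {r : ℝ} (hU : ∀ y ∈ Metric.ball x r, y ∈ U ↔
      g ((ℝ ∙ ν)ᗮ.orthogonalProjectionOnto y) < inner ℝ ν y)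
    {y : E} (hyx : y ∈ Metric.ball x (r / 4)) (hyU : y ∈ U) {s : ℝ} (hs : 0 ≤ s) (hsr : s ≤ r / 4) :
    Metric.ball (y + s • ν) (s / (L + 1)) ⊆ U := by
  intro w hw
  have hL : (0 : ℝ) < L + 1 := by positivity
  rw [Metric.mem_ball] at hyx hw
  have hys : dist (y + s • ν) y = s := by
    rw [dist_eq_norm, add_sub_cancel_left, norm_smul, hν, mul_one, Real.norm_of_nonneg hs]
  have hw' : (L + 1) * dist w (y + s • ν) < s := by rwa [lt_div_iff₀' hL] at hw
  have hws : dist w (y + s • ν) ≤ s := by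
    have : (0:ℝ) ≤ L * dist w (y + s • ν) := by positivity
    linarith
  have hr : 0 < r := by have := dist_nonneg (x := y) (y := x); linarith
  have hwx : w ∈ Metric.ball x r := by
    have := dist_triangle4 w (y + s • ν) y x
    rw [Metric.mem_ball]; linarith
  have hyx' : y ∈ Metric.ball x r := by rw [Metric.mem_ball]; linarith
  rw [hU w hwx]
  have h1 := (hU y hyx').1 hyU
  have hP : (ℝ ∙ ν)ᗮ.orthogonalProjectionOnto w - (ℝ ∙ ν)ᗮ.orthogonalProjectionOnto y =
      (ℝ ∙ ν)ᗮ.orthogonalProjectionOnto (w - (y + s • ν)) := by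
    rw [map_sub, map_add, map_smul,
      Submodule.orthogonalProjectionOnto_orthogonalComplement_singleton_eq_zero, smul_zero, add_zero]
  have h2 : g ((ℝ ∙ ν)ᗮ.orthogonalProjectionOnto w) ≤
      g ((ℝ ∙ ν)ᗮ.orthogonalProjectionOnto y) + L * dist w (y + s • ν) := by
    have h3 := hg.le_add_mul ((ℝ ∙ ν)ᗮ.orthogonalProjectionOnto w)
      ((ℝ ∙ ν)ᗮ.orthogonalProjectionOnto y)
    refine h3.trans ?_
    gcongr
    rw [dist_eq_norm, hP, dist_eq_norm]
    exact Submodule.norm_orthogonalProjectionOnto_apply_le _ _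
  have h4 : inner ℝ ν y + s - dist w (y + s • ν) ≤ inner ℝ ν w := by
    have h5 : w = (y + s • ν) + (w - (y + s • ν)) := by abel
    have h6 : |inner ℝ ν (w - (y + s • ν))| ≤ dist w (y + s • ν) := by
      rw [dist_eq_norm]
      simpa [hν] using abs_real_inner_le_norm ν (w - (y + s • ν))
    have h7 := (abs_le.1 h6).1
    rw [h5, inner_add_right, inner_add_right, inner_smul_right, real_inner_self_eq_norm_sq, hν,
      ← h5]
    linarith
  linarith

theorem exists_nhds_hasCarrotsFrom_of_graph {E : Type*} [NormedAddCommGroup E]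
    [InnerProductSpace ℝ E] [ProperSpace E] {U : Set E} (hU : IsOpen U) (hconn : IsConnected U)
    (hb : Bornology.IsBounded U) {x₀ x ν : E} (hx₀ : x₀ ∈ U) (hx : x ∉ U) (hν : ‖ν‖ = 1)
    {L : ℝ≥0} {g : (ℝ ∙ ν)ᗮ → ℝ} (hg : LipschitzWith L g) {r : ℝ} (hr : 0 < r)
    (hgU : ∀ y ∈ Metric.ball x r, y ∈ U ↔
      g ((ℝ ∙ ν)ᗮ.orthogonalProjectionOnto y) < inner ℝ ν y) :
    ∃ t ∈ nhds x, HasCarrotsFrom U x₀ t := by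
  have hne : Uᶜ.Nonempty := ⟨x, hx⟩
  have hL : (0 : ℝ) < L + 1 := by positivity
  -- The tops `e` of all vertical segments lie in this compact subset of `U`, so the interior case
  -- supplies a uniform constant `A` from there on.
  set K := Metric.closedBall x r ∩ {z | r / 4 / (L + 1) ≤ Metric.infDist z Uᶜ}
  have hKc : IsCompact K := (isCompact_closedBall x r).inter_right
    (isClosed_le continuous_const (Metric.continuous_infDist_pt _))
  have hKU : K ⊆ U := fun z hz =>
    ball_subset_of_le_infDist_compl hz.2 (Metric.mem_ball_self (by positivity))
  obtain ⟨A, hA, hcar⟩ : HasCarrotsFrom U x₀ K := hasCarrotsFrom_of_isCompact hKc fun z hz =>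
    exists_nhds_hasCarrotsFrom_of_mem hU hconn hb hx₀ (hKU hz)
  refine ⟨Metric.ball x (r / 4), Metric.ball_mem_nhds x (by positivity), (L + 1) * (1 + A) + A,
    by positivity, fun y hy => ?_⟩
  have hball : ∀ s ∈ Set.Icc 0 (r / 4), Metric.ball (y + s • ν) (s / (L + 1)) ⊆ U := fun s hs =>
    ball_add_smul_subset_of_graph hν hg hgU hy.1 hy.2 hs.1 hs.2
  have hys : ∀ s, 0 ≤ s → dist y (y + s • ν) = s := fun s hs => by
    rw [dist_comm, dist_eq_norm, add_sub_cancel_left, norm_smul, hν, mul_one,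
      Real.norm_of_nonneg hs]
  have hr4 : r / 4 ∈ Set.Icc 0 (r / 4) := ⟨by positivity, le_rfl⟩
  set e := y + (r / 4) • ν
  have hde : r / 4 / (L + 1) ≤ Metric.infDist e Uᶜ :=
    le_infDist_compl_of_ball_subset hne (hball _ hr4)
  have heK : e ∈ K := by
    refine ⟨?_, hde⟩
    have h1 := dist_triangle_left e x y
    rw [hys _ hr4.1] at h1
    have h2 := Metric.mem_ball.1 hy.1
    rw [Metric.mem_closedBall]; linarith
  obtain ⟨Γ, hΓU, hΓp, heΓ, hx₀Γ, hΓA⟩ := hcar e ⟨heK, hKU heK⟩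
  refine ⟨(fun s : ℝ => y + s • ν) '' Set.Icc 0 (r / 4) ∪ Γ, ?_, ?_, ?_, Or.inr hx₀Γ, ?_⟩
  · refine Set.union_subset ?_ hΓU
    rintro _ ⟨s, hs, rfl⟩
    rcases hs.1.eq_or_lt with h0 | h0
    · simpa [← h0] using hy.2
    · exact hball s hs (Metric.mem_ball_self (by positivity))
  · refine IsPreconnected.union e ⟨r / 4, hr4, rfl⟩ heΓ (isPreconnected_Icc.image _ ?_) hΓp
    fun_prop
  · exact Or.inl ⟨0, ⟨le_rfl, hr4.1⟩, by simp⟩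
  · rintro _ (⟨s, hs, rfl⟩ | hz)
    · refine (Metric.ball_subset_ball ?_).trans (hball s hs)
      dsimp only
      rw [hys s hs.1]
      refine div_le_div_of_nonneg_left hs.1 hL ?_
      nlinarith [mul_pos hL hA]
    · rename_i z
      -- With `d` the distance from `z` to the complement, `dist e z ≤ A * d`, and the segment
      -- length satisfies `r / 4 ≤ (L + 1) * (1 + A) * d`. Adding the two gives the chosen constant.
      have h1 := le_infDist_compl_of_ball_subset hne (hΓA z hz)
      rw [div_le_iff₀' hA] at h1
      refine ball_subset_of_le_infDist_compl ?_
      rw [div_le_iff₀' (by positivity)]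
      have h2 := infDist_compl_le_add_dist U e z
      rw [div_le_iff₀' hL] at hde
      have h3 := dist_triangle y e z
      rw [hys _ hr4.1] at h3
      have h4 : (L + 1) * Metric.infDist e Uᶜ ≤ (L + 1) * ((1 + A) * Metric.infDist z Uᶜ) := by
        gcongr; linarith
      linarith

theorem IsLipschitzDomain.exists_hasCarrots {n : ℕ} {U : Set (Rn n)} (hU : IsLipschitzDomain U) :
    ∃ x₀ ∈ U, HasCarrots U x₀ := by
  obtain ⟨x₀, hx₀⟩ := hU.isConnected.nonempty
  refine ⟨x₀, hx₀, ?_⟩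
  obtain ⟨A, hA, h⟩ : HasCarrotsFrom U x₀ (closure U) := by
    refine hasCarrotsFrom_of_isCompact hU.isBounded.isCompact_closure fun x hx => ?_
    by_cases hxU : x ∈ U
    · exact exists_nhds_hasCarrotsFrom_of_mem hU.isOpen hU.isConnected hU.isBounded hx₀ hxU
    · obtain ⟨ν, hν, L, g, hg, r, hr, hgU⟩ := hU.exists_graph x
        (by rw [hU.isOpen.frontier_eq]; exact ⟨hx, hxU⟩)
      exact exists_nhds_hasCarrotsFrom_of_graph hU.isOpen hU.isConnected hU.isBounded hx₀ hxU
        hν hg hr hgU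
  exact ⟨A, hA, fun x hx => h x ⟨subset_closure hx, hx⟩⟩

theorem HasCarrots.preimage_of_lipschitzWith {Y : Type*} [PseudoMetricSpace Y] {U : Set X} {x₀ : X}
    (h : HasCarrots U x₀) {f : X → Y} {f' : Y → X} (hff' : Function.LeftInverse f f')
    (hf'f : Function.LeftInverse f' f) {K K' : ℝ≥0} (hf : LipschitzWith K f)
    (hf' : LipschitzWith K' f') : HasCarrots (f' ⁻¹' U) (f x₀) := by
  obtain ⟨A, hA, h⟩ := h
  refine ⟨(K + 1) * (K' + 1) * A, by positivity, fun x hx => ?_⟩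
  obtain ⟨Γ, h1, h2, h3, h4, h5⟩ := h (f' x) hx
  refine ⟨f '' Γ, ?_, h2.image f hf.continuous.continuousOn, ⟨f' x, h3, hff' x⟩, ⟨x₀, h4, rfl⟩, ?_⟩
  · rintro _ ⟨z, hz, rfl⟩
    rw [Set.mem_preimage, hf'f]; exact h1 hz
  · rintro _ ⟨z, hz, rfl⟩ w hw
    refine h5 z hz ?_
    rw [Metric.mem_ball, lt_div_iff₀ (by positivity)] at hw ⊢
    have h6 := hf'.dist_le_mul w (f z)
    have h7 := hf.dist_le_mul (f' x) z
    rw [hf'f] at h6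
    rw [hff'] at h7
    have h8 : (K + 1) * (dist (f' w) z * A) ≤ (K + 1) * ((K' + 1) * dist w (f z) * A) := by
      gcongr
      nlinarith [dist_nonneg (x := w) (y := f z)]
    have h9 : (K : ℝ) * dist (f' x) z ≤ (K + 1) * dist (f' x) z := by
      nlinarith [dist_nonneg (x := f' x) (y := z)]
    have hK : (0:ℝ) < K + 1 := by positivity
    refine lt_of_mul_lt_mul_left ?_ hK.le
    linarith

end carrots

/-! ### Transport to Euclidean space and the main theorem -/

theorem exists_lintegral_rpow_le {n : ℕ} (hn : 0 < n) {q : ℝ} (hq : 1 < q)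
    {V : Set (Fin n → ℝ)} (hV : IsOpen V) (hne : Vᶜ.Nonempty) (hvol : volume V ≠ ⊤)
    {x₀ : Fin n → ℝ} (hx₀ : x₀ ∈ V) (hc : HasCarrots V x₀) :
    ∃ F : ℝ≥0, 0 < F ∧ ∀ (φ : (Fin n → ℝ) → ℝ) (s : (Fin n → ℝ) → ℝ≥0∞),
      Integrable φ → Measurable φ → OscDominated V φ s → AEMeasurable s (volume.restrict V) →
      ∫⁻ x in V, ‖φ x‖ₑ ^ q ≤
        F * ((∫⁻ x in V, s x ^ q) + ‖⨍ x in V, φ x‖ₑ ^ q * volume V) := by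
  obtain ⟨C, hC⟩ := exists_lintegral_enorm_sub_rpow_le hn hq hV hne hvol hx₀ hc
  have hq0 : 0 < q := by linarith
  set D : ℝ≥0 := 2 ^ (q - 1)
  have hD : (D : ℝ≥0∞) = 2 ^ (q - 1) := by
    rw [ENNReal.coe_rpow_of_nonneg _ (by linarith)]; rfl
  have hD0 : 0 < D := NNReal.rpow_pos two_pos
  refine ⟨(D + D ^ 2) * C + D ^ 2, by positivity, fun φ s hφ hφm hs hsm => ?_⟩
  obtain ⟨c, hc⟩ := hC φ s hφ hφm hs hsm
  have hV0 : volume V ≠ 0 := (hV.measure_pos volume ⟨x₀, hx₀⟩).ne'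
  set m := ⨍ x in V, φ x
  set I := ∫⁻ x in V, ‖φ x - c‖ₑ ^ q
  set S := ∫⁻ x in V, s x ^ q
  -- Jensen's inequality, obtained from Hölder against the constant 1; it permits replacing `c` by
  -- the mean `m`.
  have hmc : ‖m - c‖ₑ ^ q * volume V ≤ I := by
    have hpq : q.HolderConjugate q.conjExponent := Real.HolderConjugate.conjExponent hq
    have h1 : ‖m - c‖ₑ * volume V ≤ I ^ (1 / q) * volume V ^ (1 / q.conjExponent) := by
      refine (enorm_setAverage_sub_mul_le hφ hV0 hvol c).trans ?_
      have := ENNReal.lintegral_mul_le_Lp_mul_Lq (volume.restrict V) hpq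
        (f := fun x => ‖φ x - c‖ₑ) (g := fun _ => 1) (by fun_prop) aemeasurable_const
      simpa using this
    have h2 : volume V ^ (1 / q.conjExponent) * volume V ^ (1 / q) = volume V := by
      rw [← ENNReal.rpow_add _ _ hV0 hvol, one_div, one_div, hpq.symm.inv_add_inv_eq_one,
        ENNReal.rpow_one]
    have h3 : ‖m - c‖ₑ * volume V ^ (1 / q) ≤ I ^ (1 / q) := by
      have h0 : volume V ^ (1 / q.conjExponent) ≠ 0 := by
        simp [ENNReal.rpow_eq_zero_iff, hV0, hvol]
      have h1' : volume V ^ (1 / q.conjExponent) ≠ ⊤ :=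
        ENNReal.rpow_ne_top_of_nonneg hpq.symm.one_div_nonneg hvol
      refine (ENNReal.mul_le_mul_iff_left h0 h1').1 ?_
      rwa [mul_assoc, mul_comm (volume V ^ (1 / q)), h2]
    have h4 := ENNReal.rpow_le_rpow h3 hq0.le
    rwa [ENNReal.mul_rpow_of_nonneg _ _ hq0.le, ← ENNReal.rpow_mul, ← ENNReal.rpow_mul,
      one_div_mul_cancel hq0.ne', ENNReal.rpow_one, ENNReal.rpow_one] at h4
  have hpt : ∀ x, ‖φ x‖ₑ ^ q ≤ D * ‖φ x - c‖ₑ ^ q + D ^ 2 * (‖m - c‖ₑ ^ q + ‖m‖ₑ ^ q) := by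
    intro x
    have h1 : ‖φ x‖ₑ ≤ ‖φ x - c‖ₑ + (‖m - c‖ₑ + ‖m‖ₑ) := by
      calc ‖φ x‖ₑ = ‖(φ x - c) - ((m - c) - m)‖ₑ := by congr 1; ring
        _ ≤ _ := enorm_sub_le.trans (by gcongr; exact enorm_sub_le)
    calc ‖φ x‖ₑ ^ q ≤ (‖φ x - c‖ₑ + (‖m - c‖ₑ + ‖m‖ₑ)) ^ q := by gcongr
      _ ≤ D * (‖φ x - c‖ₑ ^ q + (‖m - c‖ₑ + ‖m‖ₑ) ^ q) := by
          rw [hD]; exact ENNReal.rpow_add_le_mul_rpow_add_rpow _ _ hq.le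
      _ ≤ D * (‖φ x - c‖ₑ ^ q + D * (‖m - c‖ₑ ^ q + ‖m‖ₑ ^ q)) := by
          gcongr
          rw [hD]; exact ENNReal.rpow_add_le_mul_rpow_add_rpow _ _ hq.le
      _ = _ := by ring
  calc ∫⁻ x in V, ‖φ x‖ₑ ^ q
      ≤ ∫⁻ x in V, (D * ‖φ x - c‖ₑ ^ q + D ^ 2 * (‖m - c‖ₑ ^ q + ‖m‖ₑ ^ q)) :=
        lintegral_mono hpt
    _ = D * I + D ^ 2 * (‖m - c‖ₑ ^ q * volume V + ‖m‖ₑ ^ q * volume V) := by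
        rw [lintegral_add_right _ measurable_const, lintegral_const_mul _ (by fun_prop),
          setLIntegral_const]
        ring
    _ ≤ D * (C * S) + D ^ 2 * (C * S + ‖m‖ₑ ^ q * volume V) := by
        exact add_le_add (mul_le_mul_right hc _)
          (mul_le_mul_right (add_le_add (hmc.trans hc) le_rfl) _)
    _ = (D + D ^ 2) * C * S + D ^ 2 * (‖m‖ₑ ^ q * volume V) := by ring
    _ ≤ ((D + D ^ 2) * C + D ^ 2) * S + ((D + D ^ 2) * C + D ^ 2) * (‖m‖ₑ ^ q * volume V) := by
        gcongr
        · exact le_self_add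
        · exact le_add_self
    _ = _ := by push_cast; ring

section transport

variable {n : ℕ}

theorem measurableEmbedding_ofLp (n : ℕ) :
    MeasurableEmbedding (WithLp.ofLp : Rn n → (Fin n → ℝ)) :=
  (MeasurableEquiv.toLp 2 (Fin n → ℝ)).symm.measurableEmbedding

theorem meanOsc_preimage_ofLp (φ : (Fin n → ℝ) → ℝ) (B : Set (Fin n → ℝ)) :
    meanOsc (fun x : Rn n => φ x.ofLp) (WithLp.ofLp ⁻¹' B) = piOsc φ B := by
  have hmp := PiLp.volume_preserving_ofLp (Fin n)
  have he := measurableEmbedding_ofLp n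
  have hvol := hmp.measure_preimage_emb he B
  have havg : (⨍ z in (WithLp.ofLp : Rn n → (Fin n → ℝ)) ⁻¹' B, φ z.ofLp) = ⨍ z in B, φ z := by
    rw [setAverage_eq, setAverage_eq, hmp.setIntegral_preimage_emb he φ B, measureReal_def, hvol,
      measureReal_def]
  rw [meanOsc, piOsc, havg, setLAverage_eq, setLAverage_eq, hvol,
    hmp.setLIntegral_comp_preimage_emb he (fun y => ‖φ y - ⨍ z in B, φ z‖ₑ) B]

theorem meanOsc_congr_ae {ψ ψ' : Rn n → ℝ} {Q : Set (Rn n)}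
    (h : ψ =ᵐ[volume.restrict Q] ψ') : meanOsc ψ Q = meanOsc ψ' Q := by
  rw [meanOsc, meanOsc, average_congr h]
  exact laverage_congr (h.mono fun x hx => by simp only [hx])

theorem preimage_ofLp_ball (z : Fin n → ℝ) {r : ℝ} (hr : 0 < r) :
    (WithLp.ofLp : Rn n → (Fin n → ℝ)) ⁻¹' Metric.ball z r =
      openCube (WithLp.toLp 2 fun i => z i - r) (2 * r) := by
  ext y
  rw [Set.mem_preimage, Metric.mem_ball, dist_pi_lt_iff hr]
  refine forall_congr' fun i => ?_
  rw [Real.dist_eq, abs_lt]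
  dsimp only
  constructor <;> rintro ⟨h1, h2⟩ <;> constructor <;> linarith

theorem meanOsc_le_sharpMaximal {U : Set (Rn n)} (ψ : Rn n → ℝ) {a x : Rn n} {l : ℝ} (hl : 0 < l)
    (hx : x ∈ openCube a l) (hU : openCube a l ⊆ U) :
    meanOsc ψ (openCube a l) ≤ sharpMaximal U ψ x :=
  le_iSup_of_le a <| le_iSup_of_le l <| le_iSup_of_le hl <| le_iSup_of_le hx <|
    le_iSup_of_le hU le_rfl

theorem oscDominated_sharpMaximal {U : Set (Rn n)} {ψ : Rn n → ℝ} {φ : (Fin n → ℝ) → ℝ}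
    (h : ψ =ᵐ[volume.restrict U] fun x => φ x.ofLp) :
    OscDominated (WithLp.toLp 2 ⁻¹' U) φ fun y => sharpMaximal U ψ (WithLp.toLp 2 y) := by
  intro z r hr hV x hx
  have hQ := preimage_ofLp_ball z hr
  have hsub : openCube (WithLp.toLp 2 fun i => z i - r) (2 * r) ⊆ U := by
    rw [← hQ]
    intro y hy
    exact hV hy
  rw [← meanOsc_preimage_ofLp, hQ,
    ← meanOsc_congr_ae (ae_restrict_of_ae_restrict_of_subset hsub h)]
  refine meanOsc_le_sharpMaximal ψ (by positivity) ?_ hsub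
  rw [← hQ]
  exact hx

end transport

theorem mainTheorem4 (n : ℕ) (hn : 2 ≤ n) (q : ℝ) (hq : 1 < q) (U : Set (Rn n))
    (hU : IsLipschitzDomain U ∨ IsJohnDomain U) :
    ∃ F : ℝ≥0, 0 < F ∧ ∀ ψ : Rn n → ℝ,
      MemLp ψ 1 (volume.restrict U) →
      MemLp (sharpMaximal U ψ) (ENNReal.ofReal q) (volume.restrict U) →
      MemLp ψ (ENNReal.ofReal q) (volume.restrict U) ∧
      (⨍⁻ x in U, ‖ψ x‖ₑ ^ q ∂volume) ≤
        F * ((⨍⁻ x in U, sharpMaximal U ψ x ^ q ∂volume) + ‖⨍ x in U, ψ x‖ₑ ^ q) := by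
  have hn0 : 0 < n := by omega
  have hq0 : 0 < q := by linarith
  have hdom : IsBoundedDomain U := hU.elim (·.toIsBoundedDomain) (·.toIsBoundedDomain)
  obtain ⟨x₀, hx₀, hcar⟩ : ∃ x₀ ∈ U, HasCarrots U x₀ :=
    hU.elim (·.exists_hasCarrots) (·.exists_hasCarrots)
  set V : Set (Fin n → ℝ) := WithLp.toLp 2 ⁻¹' U
  have hVU : (WithLp.ofLp : Rn n → (Fin n → ℝ)) ⁻¹' V = U := rfl
  have hmp := PiLp.volume_preserving_ofLp (Fin n)
  have he := measurableEmbedding_ofLp n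
  have hV : IsOpen V := hdom.isOpen.preimage (PiLp.continuous_toLp 2 _)
  have hvolUV : volume U = volume V := by rw [← hVU]; exact hmp.measure_preimage_emb he V
  have hU1 : volume U ≠ ⊤ := hdom.isBounded.measure_lt_top.ne
  have hU0 : volume U ≠ 0 := (hdom.isOpen.measure_pos volume ⟨x₀, hx₀⟩).ne'
  -- The whole space has infinite volume.
  have hne : Vᶜ.Nonempty := by
    have : NeZero n := ⟨hn0.ne'⟩
    rw [Set.nonempty_compl]
    intro hVuniv
    rw [hvolUV, hVuniv] at hU1
    exact hU1 (measure_univ_of_isAddLeftInvariant volume)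
  have hcarV : HasCarrots V (WithLp.ofLp x₀) := hcar.preimage_of_lipschitzWith
    (fun _ => rfl) (fun _ => rfl) (PiLp.lipschitzWith_ofLp 2 _) (PiLp.lipschitzWith_toLp 2 _)
  obtain ⟨F, hF, hmain⟩ := exists_lintegral_rpow_le hn0 hq hV hne (hvolUV ▸ hU1) hx₀ hcarV
  refine ⟨F, hF, fun ψ hψ hsharp => ?_⟩
  -- A measurable representative extended by zero is globally integrable. Only cubes inside `U`
  -- enter the sharp function, so neither change affects its oscillations.
  set φ : (Fin n → ℝ) → ℝ := V.indicator fun y => hψ.1.mk ψ (WithLp.toLp 2 y)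
  have hψφ : ψ =ᵐ[volume.restrict U] fun x => φ x.ofLp := by
    filter_upwards [hψ.1.ae_eq_mk, ae_restrict_mem hdom.isOpen.measurableSet] with x hx hxU
    have hxV : x.ofLp ∈ V := hxU
    simp only [φ, Set.indicator_of_mem hxV]
    exact hx
  have hφm : Measurable φ := (hψ.1.stronglyMeasurable_mk.measurable.comp
    (MeasurableEquiv.toLp 2 (Fin n → ℝ)).measurable).indicator hV.measurableSet
  have hφi : Integrable φ := by
    rw [← integrableOn_iff_integrable_of_support_subset Set.support_indicator_subset,
      ← hmp.integrableOn_comp_preimage he, hVU]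
    exact (memLp_one_iff_integrable.1 hψ).congr hψφ
  have hsm : AEMeasurable (fun y => sharpMaximal U ψ (WithLp.toLp 2 y)) (volume.restrict V) := by
    have h1 := (PiLp.volume_preserving_toLp (Fin n)).restrict_preimage_emb
      (MeasurableEquiv.toLp 2 (Fin n → ℝ)).measurableEmbedding U
    exact hsharp.1.aemeasurable.comp_quasiMeasurePreserving h1.quasiMeasurePreserving
  have hle := hmain φ _ hφi hφm (oscDominated_sharpMaximal hψφ) hsm
  have hIψ : ∫⁻ x in V, ‖φ x‖ₑ ^ q = ∫⁻ x in U, ‖ψ x‖ₑ ^ q := by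
    rw [← hmp.setLIntegral_comp_preimage_emb he, hVU]
    exact lintegral_congr_ae (hψφ.mono fun x hx => by simp only [hx])
  have hIs : ∫⁻ y in V, sharpMaximal U ψ (WithLp.toLp 2 y) ^ q =
      ∫⁻ x in U, sharpMaximal U ψ x ^ q := by
    rw [← hmp.setLIntegral_comp_preimage_emb he, hVU]
  have havg : ⨍ x in V, φ x = ⨍ x in U, ψ x := by
    rw [average_congr hψφ, setAverage_eq, setAverage_eq, measureReal_def, measureReal_def, hvolUV,
      ← hmp.setIntegral_preimage_emb he, hVU]
  rw [hIψ, hIs, havg, ← hvolUV] at hle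
  have hqE0 : ENNReal.ofReal q ≠ 0 := by simp [hq0]
  refine ⟨⟨hψ.1, ?_⟩, ?_⟩
  · rw [eLpNorm_lt_top_iff_lintegral_rpow_enorm_lt_top hqE0 ENNReal.ofReal_ne_top,
      ENNReal.toReal_ofReal hq0.le]
    have h1 := hsharp.2
    rw [eLpNorm_lt_top_iff_lintegral_rpow_enorm_lt_top hqE0 ENNReal.ofReal_ne_top,
      ENNReal.toReal_ofReal hq0.le] at h1
    simp only [enorm_eq_self] at h1
    refine hle.trans_lt (ENNReal.mul_lt_top ENNReal.coe_lt_top (ENNReal.add_lt_top.2 ⟨h1, ?_⟩))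
    exact ENNReal.mul_lt_top (ENNReal.rpow_lt_top_of_nonneg hq0.le enorm_ne_top) hU1.lt_top
  · rw [setLAverage_eq, setLAverage_eq]
    refine ENNReal.div_le_of_le_mul (hle.trans (le_of_eq ?_))
    rw [mul_assoc, add_mul, ENNReal.div_mul_cancel hU0 hU1]
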